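/- **Setting.** There are $n+1$ arms ($n\ge 0$), carrying arbitrary labels $0,\dots,n$. A sample of arm $i$ is an independent realization of a $[0,1]$-valued random variable with law $\nu_i$ and mean $\mu_i$; all samples are independent. There is a unique best arm $i^*$, i.e. $\mu_i<\mu_{i^*}$ for $i\ne i^*$. Put $\Delta_i=\mu_{i^*}-\mu_i$, $\mathbf H=\sum_{i\neq i^*}\Delta_i^{-2}$ and $\mathbf G=\sum_{i\ne i^*}\Delta_i^{-2}\log_2(\Delta_i^{-2})$. **Median Elimination** on a finite non-empty set $A$ of arms with accuracy $(\epsilon,\eta)$: start with $S_0=A$. In round $r=0,1,2,\dots$, as long as $|S_r|>1$, draw $\left\lceil \frac{4}{\epsilon_r^2}\log\frac{3}{\eta_r}\right\rceil$ fresh samples of each arm in $S_r$, where $\epsilon_r=(3/4)^r\epsilon/4$ and $\eta_r=\eta/2^{r+1}$, and let $S_{r+1}$ consist of the $\lceil |S_r|/2\rceil$ arms of $S_r$ with the largest empirical means (ties broken by label). Output the single arm that is left. **PRISM** with input $\delta\in(0,1)$: let $A_1$ be the set of all arms, $n_\ell=\ell 2^\ell$ and $\epsilon_\ell=\sqrt{\log(1/\delta)/2^\ell}$.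 In phase $\ell=1,2,\dots$: (1) let $i_\ell$ be the output of Median Elimination run on $A_\ell$ with accuracy $(\epsilon_\ell,\delta^\ell)$; (2) draw $n_\ell$ fresh samples of each arm $i\in A_\ell$ and let $\widehat\mu_i(\ell)$ be their average; (3) let $A_{\ell+1}=\{i\in A_\ell:\widehat\mu_i(\ell)\ge\widehat\mu_{i_\ell}(\ell)-2\epsilon_\ell\}$. Stop as soon as $A_\ell$ (including $\ell=1$) has a unique element, and output it. **Theorem.** There is a universal constant $C>0$ (independent of $\delta$, $n$ and the laws $\nu_i$) such that for every $\delta\in(0,1)$ and every instance as above, with probability at least $$1-\frac{3\delta^2}{1-\delta^2}-\frac{\delta}{1-\delta}-\frac{4\delta^2}{(1-\delta^2)^2},$$ PRISM stops after at most $$C\,\log(1/\delta)\,\bigl[\mathbf H\,\log(\log(1/\delta))+\mathbf G\bigr]$$ samples in total (those drawn inside Median Elimination included) and outputs the arm $i^*$. -/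

import Mathlib

open MeasureTheory ProbabilityTheory

namespace BestArm

/-- The average of the first `m` entries of a sequence. -/
noncomputable def empMean (y : ℕ → ℝ) (m : ℕ) : ℝ :=
  (∑ t ∈ Finset.range m, y t) / (m : ℝ)

/-! ### Median Elimination

The subroutine is run on a finite set `A` of arms with accuracy `(ε, η)`.  Its rounds are numbered
`r = 0, 1, 2, …`; `y r a t` is the `t`-th sample of arm `a` drawn in round `r`. -/

/-- Accuracy used in round `r`: it starts at `ε / 4` and is multiplied by `3 / 4` each round. -/
noncomputable def meEps (ε : ℝ) (r : ℕ) : ℝ := (3 / 4) ^ r * (ε / 4)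

/-- Confidence used in round `r`: it starts at `η / 2` and is halved each round. -/
noncomputable def meConf (η : ℝ) (r : ℕ) : ℝ := η / 2 ^ (r + 1)

/-- Number of samples of each surviving arm in round `r`, that is
`(ε_r / 2)⁻² log (3 / η_r)`, rounded up. -/
noncomputable def mePulls (ε η : ℝ) (r : ℕ) : ℕ :=
  ⌈1 / (meEps ε r / 2) ^ 2 * Real.log (3 / meConf η r)⌉₊

/-- Arm `b` is ranked before arm `a`: its empirical value is larger, or the empirical values are
equal and `b` has the smaller label. -/
def RankedBefore {n : ℕ} (p : Fin (n + 1) → ℝ) (b a : Fin (n + 1)) : Prop :=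
  p a < p b ∨ (p b = p a ∧ b < a)

open Classical in
/-- Discard the arms of `S` below the median of the empirical values `p`: the `⌈|S| / 2⌉` arms of
`S` that are ranked first are kept. -/
noncomputable def upperHalf {n : ℕ} (p : Fin (n + 1) → ℝ) (S : Finset (Fin (n + 1))) :
    Finset (Fin (n + 1)) :=
  {a ∈ S | 2 * (({b ∈ S | RankedBefore p b a} : Finset (Fin (n + 1))).card) < S.card}

/-- The set of surviving arms at the beginning of round `r`.  (It no longer changes once a single
arm is left; the algorithm stops at that moment, see `meRounds`.) -/
noncomputable def meSet {n : ℕ} (A : Finset (Fin (n + 1))) (ε η : ℝ)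
    (y : ℕ → Fin (n + 1) → ℕ → ℝ) : ℕ → Finset (Fin (n + 1))
  | 0 => A
  | r + 1 => upperHalf (fun a => empMean (y r a) (mePulls ε η r)) (meSet A ε η y r)

theorem card_upperHalf_lt {n : ℕ} (p : Fin (n + 1) → ℝ) (S : Finset (Fin (n + 1)))
    (hS : 1 < S.card) : (upperHalf p S).card < S.card := by
  classical
  refine Finset.card_lt_card ((Finset.filter_ssubset).2 ?_)
  by_contra! h
  -- a worst-ranked arm of `S` has all the other arms of `S` before it
  obtain ⟨a, ha, hmin⟩ := S.exists_min_image (fun a => toLex (p a, OrderDual.toDual a))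
    (Finset.card_pos.1 (by omega))
  have hsub : S.erase a ⊆ ({b ∈ S | RankedBefore p b a} : Finset (Fin (n + 1))) := by
    intro b hb
    obtain ⟨hne, hb⟩ := Finset.mem_erase.1 hb
    refine Finset.mem_filter.2 ⟨hb, ?_⟩
    rcases Prod.Lex.toLex_le_toLex.1 (hmin b hb) with h1 | ⟨h1, h2⟩
    · exact Or.inl h1
    · exact Or.inr ⟨h1.symm, lt_of_le_of_ne (OrderDual.toDual_le_toDual.1 h2) hne⟩
  have h1 := Finset.card_le_card hsub
  rw [Finset.card_erase_of_mem ha] at h1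
  have h2 := h a ha
  omega

/-- Median Elimination always terminates. -/
theorem exists_card_meSet_le_one {n : ℕ} (A : Finset (Fin (n + 1))) (ε η : ℝ)
    (y : ℕ → Fin (n + 1) → ℕ → ℝ) : ∃ r, (meSet A ε η y r).card ≤ 1 := by
  by_contra! h
  have key : ∀ r, (meSet A ε η y r).card + r ≤ A.card := by
    intro r
    induction r with
    | zero => simp [meSet]
    | succ k ih =>
      have := card_upperHalf_lt (fun a => empMean (y k a) (mePulls ε η k)) _ (h k)
      simp only [meSet]
      omega
  have h1 := key (A.card + 1)
  omega

open Classical in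
/-- The number of rounds performed: rounds `0, …, meRounds - 1` are carried out, and then only one
arm is left. -/
noncomputable def meRounds {n : ℕ} (A : Finset (Fin (n + 1))) (ε η : ℝ)
    (y : ℕ → Fin (n + 1) → ℕ → ℝ) : ℕ :=
  Nat.find (exists_card_meSet_le_one A ε η y)

open Classical in
/-- The output of Median Elimination: the arm that is left at the end.  (The value for empty `A`
is irrelevant.) -/
noncomputable def meOutput {n : ℕ} (A : Finset (Fin (n + 1))) (ε η : ℝ)
    (y : ℕ → Fin (n + 1) → ℕ → ℝ) : Fin (n + 1) :=
  if h : (meSet A ε η y (meRounds A ε η y)).Nonempty then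
    (meSet A ε η y (meRounds A ε η y)).min' h
  else 0

/-- The total number of samples drawn by Median Elimination. -/
noncomputable def meSamples {n : ℕ} (A : Finset (Fin (n + 1))) (ε η : ℝ)
    (y : ℕ → Fin (n + 1) → ℕ → ℝ) : ℕ :=
  ∑ r ∈ Finset.range (meRounds A ε η y), (meSet A ε η y r).card * mePulls ε η r

/-! ### PRISM -/

/-- Labels of the samples that PRISM can draw from `n + 1` arms. Every sample that is drawn has its
own label, so distinct draws are distinct realizations. -/
inductive Draw (n : ℕ) : Type
  /-- the `t`-th sample of arm `i` in round `r` of Median Elimination during phase `ℓ` -/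
  | elim (ℓ r : ℕ) (i : Fin (n + 1)) (t : ℕ) : Draw n
  /-- the `t`-th sample of arm `i` taken during phase `ℓ` after Median Elimination -/
  | est (ℓ : ℕ) (i : Fin (n + 1)) (t : ℕ) : Draw n

/-- The arm from which a sample is drawn. -/
def Draw.arm {n : ℕ} : Draw n → Fin (n + 1)
  | .elim _ _ i _ => i
  | .est _ i _ => i

/-- `n_ℓ = ℓ 2^ℓ`. -/
def phasePulls (ℓ : ℕ) : ℕ := ℓ * 2 ^ ℓ

/-- `ε_ℓ = √(log (1/δ) / 2^ℓ)`. -/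
noncomputable def phaseEps (δ : ℝ) (ℓ : ℕ) : ℝ := Real.sqrt (Real.log (1 / δ) / 2 ^ ℓ)

/-- The average `μ̂_i(ℓ)` of the `n_ℓ` samples of arm `i` taken in step (2) of phase `ℓ`, when `x`
lists the values of the samples. -/
noncomputable def muHat {n : ℕ} (x : Draw n → ℝ) (ℓ : ℕ) (i : Fin (n + 1)) : ℝ :=
  empMean (fun t => x (.est ℓ i t)) (phasePulls ℓ)

/-- The arm `i_ℓ`: the output of Median Elimination run on `A` with accuracy `(ε_ℓ, δ^ℓ)`. -/
noncomputable def phaseRef {n : ℕ} (δ : ℝ) (x : Draw n → ℝ) (ℓ : ℕ) (A : Finset (Fin (n + 1))) :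
    Fin (n + 1) :=
  meOutput A (phaseEps δ ℓ) (δ ^ ℓ) (fun r i t => x (.elim ℓ r i t))

open Classical in
/-- Phase `ℓ` of PRISM, started with the set `A`: the set of the next phase. -/
noncomputable def phaseNext {n : ℕ} (δ : ℝ) (x : Draw n → ℝ) (ℓ : ℕ) (A : Finset (Fin (n + 1))) :
    Finset (Fin (n + 1)) :=
  {i ∈ A | muHat x ℓ i ≥ muHat x ℓ (phaseRef δ x ℓ A) - 2 * phaseEps δ ℓ}

/-- The number of samples drawn in phase `ℓ` of PRISM, started with the set `A`. -/
noncomputable def phaseSamples {n : ℕ} (δ : ℝ) (x : Draw n → ℝ) (ℓ : ℕ)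
    (A : Finset (Fin (n + 1))) : ℕ :=
  meSamples A (phaseEps δ ℓ) (δ ^ ℓ) (fun r i t => x (.elim ℓ r i t)) + A.card * phasePulls ℓ

/-- The set `A_ℓ`, for `ℓ ≥ 1` (the value at `0` is not used): `A_1` consists of all arms. -/
noncomputable def activeSet {n : ℕ} (δ : ℝ) (x : Draw n → ℝ) : ℕ → Finset (Fin (n + 1))
  | 0 => Finset.univ
  | 1 => Finset.univ
  | ℓ + 2 => phaseNext δ x (ℓ + 1) (activeSet δ x (ℓ + 1))

/-- PRISM stops at the beginning of phase `L`: `L ≥ 1` is the first index for which `A_L` has a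
unique element. -/
def StopsAt {n : ℕ} (δ : ℝ) (x : Draw n → ℝ) (L : ℕ) : Prop :=
  1 ≤ L ∧ (activeSet δ x L).card = 1 ∧ ∀ ℓ, 1 ≤ ℓ → ℓ < L → (activeSet δ x ℓ).card ≠ 1

/-- The number of samples drawn in the phases `1, …, L - 1`. -/
noncomputable def samplesBefore {n : ℕ} (δ : ℝ) (x : Draw n → ℝ) (L : ℕ) : ℕ :=
  ∑ ℓ ∈ Finset.Ico 1 L, phaseSamples δ x ℓ (activeSet δ x ℓ)

/-- PRISM, run with parameter `δ` on the sample values `x`, stops after at most `B` samples and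
outputs the arm `i`. -/
def StopsWithin {n : ℕ} (δ : ℝ) (x : Draw n → ℝ) (i : Fin (n + 1)) (B : ℝ) : Prop :=
  ∃ L : ℕ, StopsAt δ x L ∧ activeSet δ x L = {i} ∧ (samplesBefore δ x L : ℝ) ≤ B

/-! ### The problem instance -/

/-- The mean of arm `i` when `ν i` is the law of its samples. -/
noncomputable def armMean {n : ℕ} (ν : Fin (n + 1) → Measure ℝ) (i : Fin (n + 1)) : ℝ :=
  ∫ z, z ∂(ν i)

/-- The gap between the arm `best` and arm `i`. -/
noncomputable def gap {n : ℕ} (ν : Fin (n + 1) → Measure ℝ) (best i : Fin (n + 1)) : ℝ :=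
  armMean ν best - armMean ν i

/-- `H = ∑ Δ_i⁻²`, over the arms other than `best`. -/
noncomputable def hardness {n : ℕ} (ν : Fin (n + 1) → Measure ℝ) (best : Fin (n + 1)) : ℝ :=
  ∑ i ∈ Finset.univ.erase best, 1 / gap ν best i ^ 2

/-- `∑ Δ_i⁻² log₂ (Δ_i⁻²)`, over the arms other than `best`. -/
noncomputable def logHardness {n : ℕ} (ν : Fin (n + 1) → Measure ℝ) (best : Fin (n + 1)) : ℝ :=
  ∑ i ∈ Finset.univ.erase best, 1 / gap ν best i ^ 2 * Real.logb 2 (1 / gap ν best i ^ 2)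

end BestArm

/-! Call phase `ℓ` accurate if Median Elimination returns an `ε_ℓ`-optimal arm of `A_ℓ`, the best
arm is not underestimated by `ε_ℓ`, and the reference arm `i_ℓ` is estimated to within `ε_ℓ`. Since
`exp(-2 n_ℓ ε_ℓ²) = δ^(2ℓ)`, this fails with probability at most `δ^ℓ + 3 δ^(2ℓ)`; summing over `ℓ`
gives two of the three error terms. The sets and reference arms are random, but determined by
earlier samples, so Hoeffding's inequality for each fixed value suffices
(`measure_random_index_le`).

If all phases are accurate, the best arm is never discarded, and an arm with gap above `5 ε_ℓ`
survives phase `ℓ` only if its own average exceeds its mean by `ε_ℓ`. A union bound over arms would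
lose a factor `n`. Instead each such overestimation is weighted by the cost `n_{ℓ+1}` of the next
phase: the expected weight is at most `12 δ²` per arm, so by Markov the total exceeds `3n` with
probability at most `4 δ²`.

Phase `ℓ` costs `O(n_ℓ (|A_ℓ| - 1))`: in Median Elimination the survivors halve while the pulls per
arm grow by about `16/9` per round. Charge `n_ℓ` to every active suboptimal arm. With `L_i` the
least `L` such that `2^L > 25 log(1/δ) / Δ_i²`, the phases up to `L_i` cost at most `2 n_{L_i}`, and
later ones are paid by the overestimation budget. Estimating `n_{L_i}` gives the bound
(`exists_level`). Termination follows too, since each phase draws a sample.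

For `δ > 7/25` the claimed probability is not positive. Otherwise `log log(1/δ) ≥ 1/6`, which
absorbs additive constants. -/

namespace BestArm

/-! ### Hoeffding bounds for empirical means -/

section Concentration

variable {Ω : Type*} [MeasurableSpace Ω] {P : Measure Ω} [IsProbabilityMeasure P]

theorem measure_add_le_empMean_le {Y : ℕ → Ω → ℝ} {c : NNReal} {μ : ℝ} (hind : iIndepFun Y P)
    (hsub : ∀ t, HasSubgaussianMGF (fun ω => Y t ω - μ) c P) (hc : c = 1 / 4)
    (m : ℕ) {e : ℝ} (he : 0 ≤ e) :
    P {ω | μ + e ≤ empMean (fun t => Y t ω) m} ≤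
      ENNReal.ofReal (Real.exp (-(2 * (m * e ^ 2)))) := by
  rcases Nat.eq_zero_or_pos m with rfl | hm
  · simpa using prob_le_one
  have hm' : (0 : ℝ) < m := by exact_mod_cast hm
  have hind' : iIndepFun (fun t ω => Y t ω - μ) P :=
    hind.comp (fun _ z => z - μ) (fun _ => by fun_prop)
  have h := HasSubgaussianMGF.measure_sum_range_ge_le_of_iIndepFun hind' (n := m)
    (fun t _ => hsub t) (ε := m * e) (by positivity)
  rw [← ofReal_measureReal]
  refine ENNReal.ofReal_le_ofReal (le_trans (le_of_eq ?_) (h.trans (le_of_eq ?_)))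
  · congr 1
    ext ω
    simp only [Set.mem_ofPred_eq, empMean, le_div_iff₀ hm', Finset.sum_sub_distrib,
      Finset.sum_const, Finset.card_range, nsmul_eq_mul]
    constructor <;> intro h <;> linarith
  · congr 1
    subst hc
    push_cast
    field_simp
    norm_num

/-- Hoeffding's inequality for both tails of the empirical mean of `[0, 1]`-valued samples. -/
theorem measure_empMean_deviation_le {Y : ℕ → Ω → ℝ} {ν : Measure ℝ} [IsProbabilityMeasure ν]
    (hν : ∀ᵐ z ∂ν, z ∈ Set.Icc (0 : ℝ) 1) (hY : ∀ t, Measurable (Y t))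
    (hlaw : ∀ t, P.map (Y t) = ν) (hind : iIndepFun Y P) (m : ℕ) {e : ℝ} (he : 0 ≤ e) :
    P {ω | ∫ z, z ∂ν + e ≤ empMean (fun t => Y t ω) m} ≤
        ENNReal.ofReal (Real.exp (-(2 * (m * e ^ 2)))) ∧
      P {ω | empMean (fun t => Y t ω) m ≤ ∫ z, z ∂ν - e} ≤
        ENNReal.ofReal (Real.exp (-(2 * (m * e ^ 2)))) := by
  have hsub : ∀ t, HasSubgaussianMGF (fun ω => Y t ω - ∫ z, z ∂ν) ((‖(1 : ℝ) - 0‖₊ / 2) ^ 2) P := by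
    intro t
    have hmem : ∀ᵐ ω ∂P, Y t ω ∈ Set.Icc (0 : ℝ) 1 := by
      rw [← hlaw t] at hν
      exact ae_of_ae_map (hY t).aemeasurable hν
    have hint : ∫ z, z ∂ν = P[Y t] := by
      rw [← hlaw t, integral_map (hY t).aemeasurable (by fun_prop)]
    rw [hint]
    exact hasSubgaussianMGF_of_mem_Icc (hY t).aemeasurable hmem
  have hc : ((‖(1 : ℝ) - 0‖₊ / 2) ^ 2 : NNReal) = 1 / 4 := by
    norm_num [div_pow]
  refine ⟨measure_add_le_empMean_le hind hsub hc m he, ?_⟩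
  have hsub' : ∀ t, HasSubgaussianMGF (fun ω => -Y t ω - -∫ z, z ∂ν)
      ((‖(1 : ℝ) - 0‖₊ / 2) ^ 2) P := by
    intro t
    convert (hsub t).neg using 1
    ext ω
    simp only [Pi.neg_apply]
    ring
  have hind' : iIndepFun (fun t ω => -Y t ω) P := hind.comp (fun _ z => -z) (fun _ => by fun_prop)
  refine le_trans (le_of_eq ?_) (measure_add_le_empMean_le hind' hsub' hc m he)
  congr 1
  ext ω
  simp only [Set.mem_ofPred_eq, empMean, Finset.sum_neg_distrib, neg_div]
  constructor <;> intro h <;> linarith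

end Concentration

/-! ### Events with an independent random index -/

section Independence

variable {κ Ω : Type*} {X : κ → Ω → ℝ}

/-- Setting the coordinates outside `D` to `0` does not affect membership in `E`, and the truncated
vector is measurable for the σ-algebra generated by the coordinates in `D`. -/
theorem measurableSet_preimage_of_dependsOn {D : Set κ} {E : Set (κ → ℝ)} (hE : MeasurableSet E)
    (hD : DependsOn (fun x => x ∈ E) D) :
    MeasurableSet[⨆ d ∈ D, MeasurableSpace.comap (X d) inferInstance] {ω | (fun d => X d ω) ∈ E} := by
  classical
  have hmeas : Measurable[⨆ d ∈ D, MeasurableSpace.comap (X d) inferInstance]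
      (fun ω d => if d ∈ D then X d ω else 0) := by
    refine @measurable_pi_lambda _ _ _ (_) _ _ fun d => ?_
    by_cases hd : d ∈ D
    · simp only [hd, if_true]
      have h1 : Measurable[MeasurableSpace.comap (X d) inferInstance] (X d) := comap_measurable _
      exact h1.mono (le_iSup₂_of_le d hd le_rfl) le_rfl
    · simp only [hd, if_false]
      exact @measurable_const _ _ _ (_) _
  have heq : {ω | (fun d => X d ω) ∈ E} = (fun ω d => if d ∈ D then X d ω else 0) ⁻¹' E := by
    ext ω
    exact (hD (x := fun d => X d ω) (y := fun d => if d ∈ D then X d ω else 0)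
      fun d hd => by simp [hd]).to_iff
  rw [heq]
  exact hmeas hE

/-- If the index `f` of an event is determined by coordinates other than those on which the events
`F s` depend, a bound on the probabilities of the events `F s` also holds for the event with the
random index `f`. -/
theorem measure_random_index_le [MeasurableSpace Ω] {P : Measure Ω} [IsProbabilityMeasure P]
    (hX : ∀ d, Measurable (X d))
    (hind : iIndepFun X P)
    {ι : Type*} [Fintype ι] {D₁ D₂ : Set κ} (hdisj : Disjoint D₁ D₂) {f : (κ → ℝ) → ι}
    (hf : ∀ s, MeasurableSet {x | f x = s}) (hfD : DependsOn f D₁) {F : ι → Set (κ → ℝ)}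
    (hF : ∀ s, MeasurableSet (F s)) (hFD : ∀ s, DependsOn (fun x => x ∈ F s) D₂)
    {q : ENNReal} (hq : ∀ s, P {ω | (fun d => X d ω) ∈ F s} ≤ q) :
    P {ω | (fun d => X d ω) ∈ F (f (fun d => X d ω))} ≤ q := by
  have hle : ∀ d, MeasurableSpace.comap (X d) inferInstance ≤ ‹MeasurableSpace Ω› :=
    fun d => (hX d).comap_le
  have hI := indep_iSup_of_disjoint hle hind hdisj
  have hfm : ∀ s, MeasurableSet {ω | f (fun d => X d ω) = s} := fun s =>
    measurableSet_preimage (measurable_pi_lambda _ hX) (hf s)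
  have hmul : ∀ s, P ({ω | f (fun d => X d ω) = s} ∩ {ω | (fun d => X d ω) ∈ F s}) =
      P {ω | f (fun d => X d ω) = s} * P {ω | (fun d => X d ω) ∈ F s} := fun s =>
    (Indep_iff _ _ _).1 hI _ _
      (measurableSet_preimage_of_dependsOn (hf s) fun x y h => by
        simp only [Set.mem_ofPred_eq, hfD h])
      (measurableSet_preimage_of_dependsOn (hF s) (hFD s))
  -- Split by the value of `f`: independence factors each piece, and the weights `P(f = s)` sum to
  -- at most `1`, so no factor `|ι|` is lost.
  calc P {ω | (fun d => X d ω) ∈ F (f (fun d => X d ω))}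
      ≤ P (⋃ s ∈ Finset.univ,
          ({ω | f (fun d => X d ω) = s} ∩ {ω | (fun d => X d ω) ∈ F s})) := by
        refine measure_mono fun ω hω => ?_
        simp only [Set.mem_iUnion]
        exact ⟨f (fun d => X d ω), Finset.mem_univ _, rfl, hω⟩
    _ ≤ ∑ s, P ({ω | f (fun d => X d ω) = s} ∩ {ω | (fun d => X d ω) ∈ F s}) :=
        measure_biUnion_finset_le _ _
    _ ≤ ∑ s, P {ω | f (fun d => X d ω) = s} * q := by
        refine Finset.sum_le_sum fun s _ => ?_
        rw [hmul]
        gcongr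
        exact hq s
    _ = P (⋃ s ∈ Finset.univ, {ω | f (fun d => X d ω) = s}) * q := by
        rw [← Finset.sum_mul, measure_biUnion_finset _ fun s _ => hfm s]
        intro s _ t _ hst
        refine Set.disjoint_left.2 fun ω h1 h2 => hst ?_
        exact h1.symm.trans h2
    _ ≤ 1 * q := by
        gcongr
        exact prob_le_one
    _ = q := one_mul q

end Independence

/-! ### Deterministic analysis of Median Elimination: accuracy and cost -/

section MedianElimination

variable {n : ℕ}

theorem rankedBefore_total (p : Fin (n + 1) → ℝ) {a b : Fin (n + 1)} (h : a ≠ b) :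
    RankedBefore p a b ∨ RankedBefore p b a := by
  rcases lt_trichotomy (p a) (p b) with h1 | h1 | h1
  · exact Or.inr (Or.inl h1)
  · rcases lt_or_gt_of_ne h with h2 | h2
    · exact Or.inl (Or.inr ⟨h1, h2⟩)
    · exact Or.inr (Or.inr ⟨h1.symm, h2⟩)
  · exact Or.inl (Or.inl h1)

theorem le_of_rankedBefore {p : Fin (n + 1) → ℝ} {a b : Fin (n + 1)} (h : RankedBefore p a b) :
    p b ≤ p a := by
  rcases h with h | ⟨h, -⟩
  · exact h.le
  · exact h.ge

theorem exists_first_ranked (p : Fin (n + 1) → ℝ) {T : Finset (Fin (n + 1))} (hT : T.Nonempty) :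
    ∃ g ∈ T, ∀ b ∈ T, ¬RankedBefore p b g := by
  obtain ⟨g, hg, hmax⟩ := T.exists_max_image (fun a => toLex (p a, OrderDual.toDual a)) hT
  refine ⟨g, hg, fun b hb hbg => ?_⟩
  rcases Prod.Lex.toLex_le_toLex.1 (hmax b hb) with h1 | ⟨h1, h2⟩
  · exact absurd (le_of_rankedBefore hbg) (not_le.2 h1)
  · rcases hbg with h | ⟨-, h⟩
    · exact absurd h1 h.ne'
    · exact absurd (OrderDual.toDual_le_toDual.1 h2) (not_le.2 h)

theorem exists_last_ranked (p : Fin (n + 1) → ℝ) {T : Finset (Fin (n + 1))} (hT : T.Nonempty) :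
    ∃ g ∈ T, ∀ b ∈ T, b ≠ g → RankedBefore p b g := by
  obtain ⟨g, hg, hmin⟩ := T.exists_min_image (fun a => toLex (p a, OrderDual.toDual a)) hT
  refine ⟨g, hg, fun b hb hne => ?_⟩
  rcases Prod.Lex.toLex_le_toLex.1 (hmin b hb) with h1 | ⟨h1, h2⟩
  · exact Or.inl h1
  · exact Or.inr ⟨h1.symm, lt_of_le_of_ne (OrderDual.toDual_le_toDual.1 h2) hne⟩

theorem upperHalf_subset (p : Fin (n + 1) → ℝ) (S : Finset (Fin (n + 1))) : upperHalf p S ⊆ S :=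
  Finset.filter_subset _ _

theorem upperHalf_nonempty (p : Fin (n + 1) → ℝ) {S : Finset (Fin (n + 1))} (hS : S.Nonempty) :
    (upperHalf p S).Nonempty := by
  classical
  obtain ⟨g, hg, hfirst⟩ := exists_first_ranked p hS
  refine ⟨g, Finset.mem_filter.2 ⟨hg, ?_⟩⟩
  rw [Finset.filter_eq_empty_iff.2 fun b hb => hfirst b hb]
  simpa using hS

theorem two_mul_card_upperHalf_le (p : Fin (n + 1) → ℝ) (S : Finset (Fin (n + 1))) :
    2 * (upperHalf p S).card ≤ S.card + 1 := by
  classical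
  rcases (upperHalf p S).eq_empty_or_nonempty with h | h
  · simp [h]
  obtain ⟨a, ha, hlast⟩ := exists_last_ranked p h
  have hsub : (upperHalf p S).erase a ⊆ ({b ∈ S | RankedBefore p b a} : Finset (Fin (n + 1))) := by
    intro b hb
    obtain ⟨hne, hb⟩ := Finset.mem_erase.1 hb
    exact Finset.mem_filter.2 ⟨upperHalf_subset p S hb, hlast b hb hne⟩
  have h1 := Finset.card_le_card hsub
  rw [Finset.card_erase_of_mem ha] at h1
  have h2 := (Finset.mem_filter.1 ha).2
  omega

theorem upperHalf_eq_self (p : Fin (n + 1) → ℝ) {S : Finset (Fin (n + 1))} (hS : S.card ≤ 1) :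
    upperHalf p S = S := by
  rcases S.eq_empty_or_nonempty with rfl | h
  · exact Finset.subset_empty.1 (upperHalf_subset p ∅)
  · refine Finset.eq_of_subset_of_card_le (upperHalf_subset p S) ?_
    have := (upperHalf_nonempty p h).card_pos
    omega

open Classical in
/-- The empirical values `p` of the arms in `S`, whose means are `μ`, are misleading at scale `e`:
the best arms of `S` are underestimated by `e / 2`, or half of the arms of `S` are overestimated by
`e / 2`. -/
def Misleading (μ p : Fin (n + 1) → ℝ) (e : ℝ) (S : Finset (Fin (n + 1))) : Prop :=
  S.Nonempty ∧ ∀ b ∈ S, (∀ a ∈ S, μ a ≤ μ b) →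
    p b ≤ μ b - e / 2 ∨ S.card ≤ 2 * ({j ∈ S | μ j + e / 2 ≤ p j} : Finset (Fin (n + 1))).card

/-- Let `b` be a best arm that is not underestimated, and `g` the first-ranked arm with mean at
least `μ b - e`. An arm `j` ranked before `g` has `μ j < μ b - e` but `p j ≥ p g ≥ p b > μ b - e /
2`, so it is overestimated. Fewer than half of the arms are, hence `g` is kept. -/
theorem exists_mem_upperHalf {μ p : Fin (n + 1) → ℝ} {e : ℝ} (he : 0 ≤ e)
    {S : Finset (Fin (n + 1))} (h : ¬Misleading μ p e S) {a : Fin (n + 1)} (ha : a ∈ S) :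
    ∃ g ∈ upperHalf p S, μ a - e ≤ μ g := by
  classical
  simp only [Misleading, not_and, not_forall, not_or, not_le] at h
  obtain ⟨b, hb, hmax, h1, h2⟩ := h ⟨a, ha⟩
  obtain ⟨g, hg, hfirst⟩ := exists_first_ranked p
    (T := {j ∈ S | μ b - e ≤ μ j}) ⟨b, Finset.mem_filter.2 ⟨hb, by linarith⟩⟩
  obtain ⟨hgS, hgμ⟩ := Finset.mem_filter.1 hg
  refine ⟨g, Finset.mem_filter.2 ⟨hgS, ?_⟩, by linarith [hmax a ha]⟩
  have hbg : p b ≤ p g := by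
    rcases eq_or_ne b g with rfl | hne
    · exact le_rfl
    · rcases rankedBefore_total p hne with h3 | h3
      · exact absurd h3 (hfirst b (Finset.mem_filter.2 ⟨hb, by linarith⟩))
      · exact le_of_rankedBefore h3
  have hsub : ({j ∈ S | RankedBefore p j g} : Finset (Fin (n + 1))) ⊆
      {j ∈ S | μ j + e / 2 ≤ p j} := by
    intro j hj
    obtain ⟨hjS, hj⟩ := Finset.mem_filter.1 hj
    refine Finset.mem_filter.2 ⟨hjS, ?_⟩
    have h3 : μ j < μ b - e := by
      by_contra! h4
      exact hfirst j (Finset.mem_filter.2 ⟨hjS, h4⟩) hj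
    linarith [le_of_rankedBefore hj]
  have h4 := Finset.card_le_card hsub
  omega

variable (A : Finset (Fin (n + 1))) (ε η : ℝ) (y : ℕ → Fin (n + 1) → ℕ → ℝ)

theorem meSet_nonempty {A : Finset (Fin (n + 1))} (hA : A.Nonempty) (r : ℕ) :
    (meSet A ε η y r).Nonempty := by
  induction r with
  | zero => exact hA
  | succ r ih => exact upperHalf_nonempty _ ih

theorem meSet_add_eq {r : ℕ} (h : (meSet A ε η y r).card ≤ 1) (k : ℕ) :
    meSet A ε η y (r + k) = meSet A ε η y r := by
  induction k with
  | zero => rfl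
  | succ k ih =>
    rw [← add_assoc, meSet, ih]
    exact upperHalf_eq_self _ h

theorem card_meSet_meRounds_le : (meSet A ε η y (meRounds A ε η y)).card ≤ 1 := by
  classical
  exact Nat.find_spec (exists_card_meSet_le_one A ε η y)

theorem one_lt_card_meSet {r : ℕ} (hr : r < meRounds A ε η y) : 1 < (meSet A ε η y r).card := by
  classical
  exact not_le.1 (Nat.find_min (exists_card_meSet_le_one A ε η y) hr)

theorem meRounds_le_card : meRounds A ε η y ≤ A.card := by
  have key : ∀ r, r ≤ meRounds A ε η y → (meSet A ε η y r).card + r ≤ A.card := by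
    intro r
    induction r with
    | zero => simp [meSet]
    | succ k ih =>
      intro hk
      have h1 := card_upperHalf_lt (fun a => empMean (y k a) (mePulls ε η k)) _
        (one_lt_card_meSet A ε η y hk)
      have h2 := ih (by omega)
      simp only [meSet]
      omega
  have := key _ le_rfl
  omega

open Classical in
/-- The least element of a finite set of arms, and `0` for the empty set. -/
noncomputable def firstArm (S : Finset (Fin (n + 1))) : Fin (n + 1) :=
  if h : S.Nonempty then S.min' h else 0

/-- The surviving set is constant once it has one element, so the data-dependent number of rounds
can be replaced by the fixed number `A.card`. This makes measurability of the output immediate. -/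
theorem meOutput_eq : meOutput A ε η y = firstArm (meSet A ε η y A.card) := by
  obtain ⟨k, hk⟩ := Nat.exists_eq_add_of_le (meRounds_le_card A ε η y)
  rw [hk, meSet_add_eq A ε η y (card_meSet_meRounds_le A ε η y)]
  rfl

theorem meOutput_mem_meSet {A : Finset (Fin (n + 1))} (hA : A.Nonempty) :
    meOutput A ε η y ∈ meSet A ε η y (meRounds A ε η y) := by
  have h := meSet_nonempty ε η y hA (meRounds A ε η y)
  rw [meOutput, dif_pos h]
  exact Finset.min'_mem _ _

theorem sum_meEps (r : ℕ) : ∑ k ∈ Finset.range r, meEps ε k = ε * (1 - (3 / 4) ^ r) := by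
  induction r with
  | zero => simp
  | succ r ih => rw [Finset.sum_range_succ, ih, meEps]; ring

/-- If no round is misleading, the output of Median Elimination is `ε`-optimal. -/
theorem le_meOutput {μ : Fin (n + 1) → ℝ} (hε : 0 ≤ ε)
    (h : ∀ r, ¬Misleading μ (fun a => empMean (y r a) (mePulls ε η r)) (meEps ε r)
      (meSet A ε η y r)) {a : Fin (n + 1)} (ha : a ∈ A) :
    μ a - ε ≤ μ (meOutput A ε η y) := by
  -- The near-optimal witness may change from round to round, losing at most `meEps ε k` in round
  -- `k`; the losses sum to `ε (1 - (3/4)^r)`.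
  have key : ∀ r, ∃ g ∈ meSet A ε η y r, μ a - ∑ k ∈ Finset.range r, meEps ε k ≤ μ g := by
    intro r
    induction r with
    | zero => exact ⟨a, ha, by simp⟩
    | succ r ih =>
      obtain ⟨g, hg, hle⟩ := ih
      obtain ⟨g', hg', hle'⟩ := exists_mem_upperHalf (by unfold meEps; positivity) (h r) hg
      refine ⟨g', hg', ?_⟩
      rw [Finset.sum_range_succ]
      linarith
  obtain ⟨g, hg, hle⟩ := key (meRounds A ε η y)
  have : g = meOutput A ε η y := Finset.card_le_one.1 (card_meSet_meRounds_le A ε η y) _ hg _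
    (meOutput_mem_meSet ε η y ⟨a, ha⟩)
  rw [sum_meEps] at hle
  rw [← this]
  have : 0 ≤ ε * (3 / 4) ^ meRounds A ε η y := by positivity
  linarith

/-- Subtracting `1` makes the rounding harmless: `⌈s/2⌉ - 1 ≤ (s - 1)/2`. -/
theorem card_meSet_le (r : ℕ) :
    ((meSet A ε η y r).card - 1 : ℝ) ≤ (A.card - 1) * (1 / 2) ^ r := by
  induction r with
  | zero => simp [meSet]
  | succ r ih =>
    have h := two_mul_card_upperHalf_le (fun a => empMean (y r a) (mePulls ε η r))
      (meSet A ε η y r)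
    have h' : (2 * (meSet A ε η y (r + 1)).card : ℝ) ≤ (meSet A ε η y r).card + 1 := by
      exact_mod_cast h
    rw [pow_succ]
    linarith

/-- The ratio `16/9` is `(4/3)²`, from the shrinking accuracy, and `r + 3` comes from the shrinking
confidence. The factor `64` is `(4 · 2)²`; rounding up adds at most `1`, whence `65`. In phase `ℓ`
the parameter `Q` will be `n_ℓ`. -/
theorem mePulls_le {ε η : ℝ} {Q : ℝ} (hε : 0 < ε) (hη : 0 < η) (hQ : 1 ≤ Q)
    (h : ∀ r : ℕ, 1 / ε ^ 2 * (Real.log (1 / η) + 2 + r) ≤ Q * (3 + r)) (r : ℕ) :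
    (mePulls ε η r : ℝ) ≤ 65 * Q * ((16 / 9) ^ r * (r + 3)) := by
  have hlog : Real.log (3 / meConf η r) ≤ Real.log (1 / η) + 2 + r := by
    have h1 : 3 / meConf η r = 1 / η * (6 * 2 ^ r) := by
      unfold meConf
      field_simp
      ring
    rw [h1, Real.log_mul (by positivity) (by positivity), Real.log_mul (by norm_num) (by positivity),
      Real.log_pow]
    have h2 : Real.log 2 ≤ 1 := by linarith [Real.log_two_lt_d9]
    have h6 : Real.log 6 ≤ 2 := by
      rw [Real.log_le_iff_le_exp (by norm_num)]
      have h3 : Real.exp 2 = Real.exp 1 ^ 2 := by rw [← Real.exp_nat_mul]; norm_num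
      rw [h3]
      nlinarith [Real.exp_one_gt_d9]
    have h4 : (r : ℝ) * Real.log 2 ≤ r * 1 := by gcongr
    linarith
  have heps : 1 / (meEps ε r / 2) ^ 2 = 64 * (16 / 9) ^ r * (1 / ε ^ 2) := by
    unfold meEps
    have : ((16 / 9 : ℝ)) ^ r = 1 / ((3 / 4) ^ r) ^ 2 := by
      rw [← pow_mul, mul_comm r 2, pow_mul, ← one_div_pow]
      norm_num
    rw [this]
    field_simp
    norm_num
  have h1 : (1 : ℝ) ≤ (16 / 9) ^ r := one_le_pow₀ (by norm_num)
  have h2 : 1 / (meEps ε r / 2) ^ 2 * Real.log (3 / meConf η r) ≤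
      64 * Q * ((16 / 9) ^ r * (r + 3)) := by
    rw [heps]
    calc 64 * (16 / 9) ^ r * (1 / ε ^ 2) * Real.log (3 / meConf η r)
        ≤ 64 * (16 / 9) ^ r * (1 / ε ^ 2) * (Real.log (1 / η) + 2 + r) := by gcongr
      _ = 64 * (16 / 9) ^ r * (1 / ε ^ 2 * (Real.log (1 / η) + 2 + r)) := by ring
      _ ≤ 64 * (16 / 9) ^ r * (Q * (3 + r)) := mul_le_mul_of_nonneg_left (h r) (by positivity)
      _ = _ := by ring
  have h3 : (1 : ℝ) ≤ Q * ((16 / 9) ^ r * (r + 3)) := by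
    have : (1 : ℝ) ≤ r + 3 := by linarith [(Nat.cast_nonneg r : (0 : ℝ) ≤ r)]
    exact one_le_mul_of_one_le_of_one_le hQ (one_le_mul_of_one_le_of_one_le h1 this)
  have h4 : (mePulls ε η r : ℝ) ≤ 64 * Q * ((16 / 9) ^ r * (r + 3)) + 1 := by
    unfold mePulls
    have h5 : (0 : ℝ) ≤ 64 * Q * ((16 / 9) ^ r * (r + 3)) := by positivity
    calc (⌈1 / (meEps ε r / 2) ^ 2 * Real.log (3 / meConf η r)⌉₊ : ℝ)
        ≤ (⌈64 * Q * ((16 / 9) ^ r * (r + 3))⌉₊ : ℝ) := by exact_mod_cast Nat.ceil_mono h2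
      _ ≤ _ := (Nat.ceil_lt_add_one h5).le
  linarith

theorem meSamples_le {A : Finset (Fin (n + 1))} (hA : A.Nonempty) {ε η Q : ℝ} (hε : 0 < ε)
    (hη : 0 < η) (hQ : 1 ≤ Q)
    (h : ∀ r : ℕ, 1 / ε ^ 2 * (Real.log (1 / η) + 2 + r) ≤ Q * (3 + r)) :
    (meSamples A ε η y : ℝ) ≤ 12870 * Q * (A.card - 1) := by
  have hA1 : (0 : ℝ) ≤ A.card - 1 := by
    have : (1 : ℝ) ≤ A.card := by exact_mod_cast hA.card_pos
    linarith
  -- Survivors contribute `(1/2)^r` and pulls `(16/9)^r`, so the ratio is `8/9`; the full series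
  -- sums to `99`.
  have hgeom : ∀ R : ℕ, ∑ r ∈ Finset.range R, ((8 / 9 : ℝ) ^ r * (r + 3)) =
      99 - (9 * R + 99) * (8 / 9) ^ R := by
    intro R
    induction R with
    | zero => simp
    | succ R ih => rw [Finset.sum_range_succ, ih, pow_succ]; push_cast; ring
  unfold meSamples
  push_cast
  calc ∑ r ∈ Finset.range (meRounds A ε η y), ((meSet A ε η y r).card : ℝ) * mePulls ε η r
      ≤ ∑ r ∈ Finset.range (meRounds A ε η y),
          130 * Q * (A.card - 1) * ((8 / 9) ^ r * (r + 3)) := by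
        refine Finset.sum_le_sum fun r hr => ?_
        -- Before the last round `s ≥ 2`, so `s ≤ 2 (s - 1)`; this doubles `65` to `130`.
        have h1 : (2 : ℝ) ≤ (meSet A ε η y r).card := by
          exact_mod_cast one_lt_card_meSet A ε η y (Finset.mem_range.1 hr)
        have h2 := card_meSet_le A ε η y r
        have h3 : ((meSet A ε η y r).card : ℝ) ≤ 2 * ((A.card - 1) * (1 / 2) ^ r) := by linarith
        calc ((meSet A ε η y r).card : ℝ) * mePulls ε η r
            ≤ 2 * ((A.card - 1) * (1 / 2) ^ r) * (65 * Q * ((16 / 9) ^ r * (r + 3))) :=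
              mul_le_mul h3 (mePulls_le hε hη hQ h r) (by positivity) (by positivity)
          _ = 130 * Q * (A.card - 1) * (((1 / 2) ^ r * (16 / 9) ^ r) * (r + 3)) := by ring
          _ = _ := by rw [← mul_pow]; norm_num
    _ = 130 * Q * (A.card - 1) *
          (99 - (9 * (meRounds A ε η y) + 99) * (8 / 9) ^ meRounds A ε η y) := by
        rw [← Finset.mul_sum, hgeom]
    _ ≤ 130 * Q * (A.card - 1) * 99 := by
        gcongr
        have : (0 : ℝ) ≤ (9 * (meRounds A ε η y) + 99) * (8 / 9) ^ meRounds A ε η y := by positivity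
        linarith
    _ = _ := by ring

end MedianElimination

/-! ### Measurability, and the probability of a misleading round -/

section Measurability

variable {n : ℕ} {α : Type*} [MeasurableSpace α]

theorem measurableSet_comp_eq {ι ι' : Type*} [Countable ι] {f : α → ι}
    (hf : ∀ t, MeasurableSet {x | f x = t}) {g : ι → α → ι'}
    (hg : ∀ t s, MeasurableSet {x | g t x = s}) (s : ι') : MeasurableSet {x | g (f x) x = s} := by
  have : {x | g (f x) x = s} = ⋃ t, ({x | f x = t} ∩ {x | g t x = s}) := by
    ext x
    simp
  rw [this]
  exact MeasurableSet.iUnion fun t => (hf t).inter (hg t s)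

theorem measurable_card_filter {ι : Type*} (S : Finset ι) {q : α → ι → Prop}
    [∀ x, DecidablePred (q x)] (hq : ∀ j, MeasurableSet {x | q x j}) :
    Measurable fun x => ({j ∈ S | q x j} : Finset ι).card := by
  simp only [Finset.card_filter]
  exact Finset.measurable_fun_sum _ fun j _ =>
    Measurable.ite (hq j) measurable_const measurable_const

theorem measurableSet_finset_eq {f : α → Finset (Fin (n + 1))}
    (hf : ∀ a, MeasurableSet {x | a ∈ f x}) (S : Finset (Fin (n + 1))) :
    MeasurableSet {x | f x = S} := by
  simp only [Finset.ext_iff]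
  rw [Set.ofPred_forall]
  refine MeasurableSet.iInter fun a => ?_
  by_cases ha : a ∈ S
  · simpa [ha] using hf a
  · have : {x | a ∈ f x ↔ a ∈ S} = {x | a ∈ f x}ᶜ := by
      ext x
      simp [ha]
    rw [this]
    exact (hf a).compl

theorem measurableSet_upperHalf_eq {p : α → Fin (n + 1) → ℝ} (hp : ∀ a, Measurable fun x => p x a)
    (S S' : Finset (Fin (n + 1))) : MeasurableSet {x | upperHalf (p x) S = S'} := by
  classical
  refine measurableSet_finset_eq (fun a => ?_) S'
  by_cases ha : a ∈ S
  · simp only [upperHalf, Finset.mem_filter, ha, true_and]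
    refine measurableSet_lt (Measurable.const_mul (measurable_card_filter S fun b => ?_) 2)
      measurable_const
    exact (measurableSet_lt (hp a) (hp b)).union
      ((measurableSet_eq_fun (hp b) (hp a)).inter (MeasurableSet.const _))
  · simp [upperHalf, ha]

theorem measurable_empMean {y : α → ℕ → ℝ} (hy : ∀ t, Measurable fun x => y x t) (m : ℕ) :
    Measurable fun x => empMean (y x) m :=
  (Finset.measurable_fun_sum _ fun t _ => hy t).div_const _

theorem measurableSet_meSet_eq {y : α → ℕ → Fin (n + 1) → ℕ → ℝ}
    (hy : ∀ r a t, Measurable fun x => y x r a t) (A : Finset (Fin (n + 1))) (ε η : ℝ) (r : ℕ)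
    (S : Finset (Fin (n + 1))) : MeasurableSet {x | meSet A ε η (y x) r = S} := by
  induction r generalizing S with
  | zero =>
    simp only [meSet]
    exact MeasurableSet.const _
  | succ r ih =>
    exact measurableSet_comp_eq (g := fun T x => upperHalf _ T) ih (fun T S =>
      measurableSet_upperHalf_eq (fun a => measurable_empMean (hy r a) _) T S) S

theorem measurableSet_misleading {p : α → Fin (n + 1) → ℝ} (hp : ∀ a, Measurable fun x => p x a)
    (μ : Fin (n + 1) → ℝ) (e : ℝ) (S : Finset (Fin (n + 1))) :
    MeasurableSet {x | Misleading μ (p x) e S} := by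
  classical
  unfold Misleading
  rw [Set.ofPred_and]
  refine (MeasurableSet.const _).inter ?_
  simp only [Set.ofPred_forall]
  refine MeasurableSet.iInter fun b => MeasurableSet.iInter fun _ => MeasurableSet.iInter fun _ => ?_
  rw [Set.ofPred_or]
  refine (measurableSet_le (hp b) measurable_const).union (measurableSet_le measurable_const ?_)
  exact Measurable.const_mul
    (measurable_card_filter S fun j => measurableSet_le measurable_const (hp j)) 2

/-- A bound `q` on the tails of the empirical values controls the probability that they are
misleading. -/
theorem measure_misleading_le {P : Measure α} {p : α → Fin (n + 1) → ℝ}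
    (hp : ∀ a, Measurable fun x => p x a) (μ : Fin (n + 1) → ℝ) (e : ℝ) {q : ENNReal}
    (hge : ∀ j, P {x | μ j + e / 2 ≤ p x j} ≤ q) (hle : ∀ j, P {x | p x j ≤ μ j - e / 2} ≤ q)
    (S : Finset (Fin (n + 1))) : P {x | Misleading μ (p x) e S} ≤ 3 * q := by
  classical
  rcases S.eq_empty_or_nonempty with rfl | hS
  · simp [Misleading]
  obtain ⟨b, hb, hmax⟩ := S.exists_max_image μ hS
  have hcard : (S.card : ENNReal) ≠ 0 := by exact_mod_cast hS.card_pos.ne'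
  have hmeas : ∀ j, MeasurableSet {x | μ j + e / 2 ≤ p x j} := fun j =>
    measurableSet_le measurable_const (hp j)
  -- Twice the number of overestimated arms, with mean at most `2 |S| q`. Markov's inequality at
  -- level `|S|` gives `2q`, however the arms depend on each other; underestimation of `b` adds
  -- another `q`.
  set f : α → ENNReal := fun x =>
    2 * ∑ j ∈ S, {x | μ j + e / 2 ≤ p x j}.indicator (fun _ => 1) x with hf
  have hfm : Measurable f :=
    (Finset.measurable_fun_sum _ fun j _ => measurable_const.indicator (hmeas j)).const_mul 2
  have hint : ∫⁻ x, f x ∂P ≤ S.card * (2 * q) := by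
    rw [hf, lintegral_const_mul _
      (Finset.measurable_fun_sum _ fun j _ => measurable_const.indicator (hmeas j)),
      lintegral_finsetSum _ fun j _ => measurable_const.indicator (hmeas j)]
    calc 2 * ∑ j ∈ S, ∫⁻ x, {x | μ j + e / 2 ≤ p x j}.indicator (fun _ => 1) x ∂P
        ≤ 2 * ∑ j ∈ S, q := by
          gcongr with j
          rw [lintegral_indicator (hmeas j)]
          simpa using hge j
      _ = S.card * (2 * q) := by
          rw [Finset.sum_const, nsmul_eq_mul]
          ring
  have hmarkov : P {x | (S.card : ENNReal) ≤ f x} ≤ 2 * q := by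
    have h1 := (mul_meas_ge_le_lintegral hfm (S.card : ENNReal)).trans hint
    exact (ENNReal.mul_le_mul_iff_right hcard (ENNReal.natCast_ne_top _)).1 h1
  have hsub : {x | Misleading μ (p x) e S} ⊆
      {x | p x b ≤ μ b - e / 2} ∪ {x | (S.card : ENNReal) ≤ f x} := by
    intro x hx
    rcases hx.2 b hb hmax with h | h
    · exact Or.inl h
    · refine Or.inr ?_
      have h' : (S.card : ENNReal) ≤
          2 * (({j ∈ S | μ j + e / 2 ≤ p x j} : Finset (Fin (n + 1))).card : ENNReal) := by
        exact_mod_cast h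
      simpa [hf, Set.indicator_apply] using h'
  calc P {x | Misleading μ (p x) e S}
      ≤ P {x | p x b ≤ μ b - e / 2} + P {x | (S.card : ENNReal) ≤ f x} :=
        (measure_mono hsub).trans (measure_union_le _ _)
    _ ≤ q + 2 * q := add_le_add (hle b) hmarkov
    _ = 3 * q := by ring

end Measurability

/-! ### Which samples determine which random choices -/

section Dependence

variable {n : ℕ}

theorem meSet_congr (A : Finset (Fin (n + 1))) (ε η : ℝ) {y y' : ℕ → Fin (n + 1) → ℕ → ℝ} {r : ℕ}
    (h : ∀ k < r, y k = y' k) : meSet A ε η y r = meSet A ε η y' r := by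
  induction r with
  | zero => rfl
  | succ r ih => rw [meSet, meSet, ih fun k hk => h k (by omega), h r (by omega)]

theorem measurableSet_phaseRef_eq (δ : ℝ) (ℓ : ℕ) (A : Finset (Fin (n + 1))) (i : Fin (n + 1)) :
    MeasurableSet {x | phaseRef δ x ℓ A = i} := by
  simp only [phaseRef, meOutput_eq]
  exact measurableSet_comp_eq (g := fun S _ => firstArm S)
    (measurableSet_meSet_eq (fun _ _ _ => measurable_pi_apply _) A _ _ _)
    (fun _ _ => MeasurableSet.const _) i

theorem measurable_muHat (ℓ : ℕ) (i : Fin (n + 1)) : Measurable fun x => muHat x ℓ i :=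
  measurable_empMean (fun _ => measurable_pi_apply _) _

theorem measurableSet_phaseNext_eq (δ : ℝ) (ℓ : ℕ) (A S : Finset (Fin (n + 1))) :
    MeasurableSet {x | phaseNext δ x ℓ A = S} := by
  classical
  have h := measurableSet_comp_eq (measurableSet_phaseRef_eq δ ℓ A)
    (g := fun j x => ({i ∈ A | muHat x ℓ i ≥ muHat x ℓ j - 2 * phaseEps δ ℓ} :
      Finset (Fin (n + 1)))) (fun j => measurableSet_finset_eq fun a => ?_) S
  · convert h using 4
    unfold phaseNext
    congr
  · simp only [Finset.mem_filter]
    exact (MeasurableSet.const _).inter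
      (measurableSet_le ((measurable_muHat ℓ j).sub_const _) (measurable_muHat ℓ a))

theorem measurableSet_activeSet_eq (δ : ℝ) (ℓ : ℕ) (S : Finset (Fin (n + 1))) :
    MeasurableSet {x | activeSet δ x ℓ = S} := by
  match ℓ with
  | 0 =>
    simp only [activeSet]
    exact MeasurableSet.const _
  | 1 =>
    simp only [activeSet]
    exact MeasurableSet.const _
  | ℓ + 2 =>
    exact measurableSet_comp_eq (g := fun T x => phaseNext δ x (ℓ + 1) T)
      (measurableSet_activeSet_eq δ (ℓ + 1)) (measurableSet_phaseNext_eq δ (ℓ + 1)) S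

/-- The phase in which a sample is drawn. -/
def Draw.phase : Draw n → ℕ
  | .elim ℓ _ _ _ => ℓ
  | .est ℓ _ _ => ℓ

/-- The samples that are drawn before phase `ℓ`. -/
def beforePhase (n ℓ : ℕ) : Set (Draw n) := {d | d.phase < ℓ}

/-- The samples that are drawn before round `r` of Median Elimination in phase `ℓ`. -/
def beforeRound (n ℓ r : ℕ) : Set (Draw n) :=
  beforePhase n ℓ ∪ {d | ∃ k < r, ∃ i t, d = .elim ℓ k i t}

/-- The samples that are drawn before step (2) of phase `ℓ`. -/
def beforeEst (n ℓ : ℕ) : Set (Draw n) :=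
  beforePhase n ℓ ∪ {d | ∃ k i t, d = .elim ℓ k i t}

theorem dependsOn_activeSet (δ : ℝ) (ℓ : ℕ) :
    DependsOn (fun x : Draw n → ℝ => activeSet δ x ℓ) (beforePhase n ℓ) := by
  intro x x' h
  match ℓ with
  | 0 => rfl
  | 1 => rfl
  | ℓ + 2 =>
    have h1 : activeSet δ x (ℓ + 1) = activeSet δ x' (ℓ + 1) :=
      dependsOn_activeSet δ (ℓ + 1) fun d (hd : d.phase < ℓ + 1) =>
        h d (show d.phase < ℓ + 2 by omega)
    have h2 : (fun r i t => x (.elim (ℓ + 1) r i t)) = fun r i t => x' (.elim (ℓ + 1) r i t) := by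
      ext r i t
      exact h _ (show ℓ + 1 < ℓ + 2 by omega)
    have h3 : (fun i t => x (.est (ℓ + 1) i t)) = fun i t => x' (.est (ℓ + 1) i t) := by
      ext i t
      exact h _ (show ℓ + 1 < ℓ + 2 by omega)
    have h4 : muHat x (ℓ + 1) = muHat x' (ℓ + 1) := by
      ext i
      exact congrArg (fun y => empMean y (phasePulls (ℓ + 1))) (congrFun h3 i)
    simp only [activeSet, phaseNext, phaseRef, h1, h2, h4]
    congr

theorem dependsOn_meSet_activeSet (δ ε η : ℝ) (ℓ r : ℕ) :
    DependsOn (fun x : Draw n → ℝ =>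
      meSet (activeSet δ x ℓ) ε η (fun r i t => x (.elim ℓ r i t)) r) (beforeRound n ℓ r) := by
  intro x x' h
  have h1 : activeSet δ x ℓ = activeSet δ x' ℓ :=
    dependsOn_activeSet δ ℓ fun d hd => h d (Or.inl hd)
  simp only [h1]
  refine meSet_congr _ _ _ fun k hk => ?_
  ext i t
  exact h _ (Or.inr ⟨k, hk, i, t, rfl⟩)

theorem dependsOn_phaseRef_activeSet (δ : ℝ) (ℓ : ℕ) :
    DependsOn (fun x : Draw n → ℝ => phaseRef δ x ℓ (activeSet δ x ℓ)) (beforeEst n ℓ) := by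
  intro x x' h
  have h1 : activeSet δ x ℓ = activeSet δ x' ℓ :=
    dependsOn_activeSet δ ℓ fun d hd => h d (Or.inl hd)
  have h2 : (fun r i t => x (.elim ℓ r i t)) = fun r i t => x' (.elim ℓ r i t) := by
    ext r i t
    exact h _ (Or.inr ⟨r, i, t, rfl⟩)
  simp only [phaseRef, h1, h2]

theorem dependsOn_muHat (ℓ : ℕ) (i : Fin (n + 1)) :
    DependsOn (fun x : Draw n → ℝ => muHat x ℓ i) {d | ∃ i t, d = .est ℓ i t} := by
  intro x x' h
  have h1 : (fun t => x (.est ℓ i t)) = fun t => x' (.est ℓ i t) := by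
    ext t
    exact h _ ⟨i, t, rfl⟩
  simp only [muHat, h1]

theorem disjoint_beforeEst (ℓ : ℕ) :
    Disjoint (beforeEst n ℓ) {d | ∃ i t, d = .est ℓ i t} := by
  refine Set.disjoint_left.2 ?_
  rintro d (hd | ⟨k, i, t, rfl⟩) ⟨i', t', h⟩
  · subst h
    exact lt_irrefl ℓ hd
  · cases h

theorem disjoint_beforeRound (ℓ r : ℕ) :
    Disjoint (beforeRound n ℓ r) {d | ∃ i t, d = .elim ℓ r i t} := by
  refine Set.disjoint_left.2 ?_
  rintro d (hd | ⟨k, hk, i, t, rfl⟩) ⟨i', t', h⟩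
  · subst h
    exact lt_irrefl ℓ hd
  · cases h
    exact lt_irrefl _ hk

end Dependence

/-! ### Failure probability of the phases and the overestimation budget -/

section Probability

variable {n : ℕ} {Ω : Type*} [MeasurableSpace Ω]

/-- The variables `X` are independent samples of arms with `[0, 1]`-valued laws `ν`. -/
structure IsSampling (ν : Fin (n + 1) → Measure ℝ) (X : Draw n → Ω → ℝ) (P : Measure Ω) :
    Prop where
  prob : ∀ i, IsProbabilityMeasure (ν i)
  mem_Icc : ∀ i, ∀ᵐ z ∂(ν i), z ∈ Set.Icc (0 : ℝ) 1
  measurable : ∀ d, Measurable (X d)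
  map_eq : ∀ d, P.map (X d) = ν d.arm
  indep : iIndepFun X P

/-- All comparisons made in phase `ℓ` with the arm `best` and with the output of Median Elimination
are accurate. -/
structure PhaseAccurate (δ : ℝ) (μ : Fin (n + 1) → ℝ) (best : Fin (n + 1)) (x : Draw n → ℝ)
    (ℓ : ℕ) : Prop where
  le_ref : ∀ a ∈ activeSet δ x ℓ,
    μ a - phaseEps δ ℓ ≤ μ (phaseRef δ x ℓ (activeSet δ x ℓ))
  lt_best : μ best - phaseEps δ ℓ < muHat x ℓ best
  ref_lt : muHat x ℓ (phaseRef δ x ℓ (activeSet δ x ℓ)) <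
    μ (phaseRef δ x ℓ (activeSet δ x ℓ)) + phaseEps δ ℓ
  lt_ref : μ (phaseRef δ x ℓ (activeSet δ x ℓ)) - phaseEps δ ℓ <
    muHat x ℓ (phaseRef δ x ℓ (activeSet δ x ℓ))

theorem phaseEps_sq {δ : ℝ} (hδ : 0 < δ) (hδ1 : δ < 1) (ℓ : ℕ) :
    phaseEps δ ℓ ^ 2 = Real.log (1 / δ) / 2 ^ ℓ := by
  have : 0 ≤ Real.log (1 / δ) := Real.log_nonneg (by rw [le_div_iff₀ hδ]; linarith)
  exact Real.sq_sqrt (by positivity)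

theorem phaseEps_pos {δ : ℝ} (hδ : 0 < δ) (hδ1 : δ < 1) (ℓ : ℕ) : 0 < phaseEps δ ℓ := by
  have : 0 < Real.log (1 / δ) := Real.log_pos (by rw [lt_div_iff₀ hδ]; linarith)
  exact Real.sqrt_pos.2 (by positivity)

/-- The choice of `n_ℓ` and `ε_ℓ` makes `n_ℓ ε_ℓ² = ℓ log(1/δ)`. -/
theorem exp_phasePulls {δ : ℝ} (hδ : 0 < δ) (hδ1 : δ < 1) (ℓ : ℕ) :
    Real.exp (-(2 * (phasePulls ℓ * phaseEps δ ℓ ^ 2))) = (δ ^ 2) ^ ℓ := by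
  have h : -(2 * ((phasePulls ℓ : ℝ) * phaseEps δ ℓ ^ 2)) = ((2 * ℓ : ℕ) : ℝ) * Real.log δ := by
    rw [phaseEps_sq hδ hδ1, one_div, Real.log_inv, phasePulls]
    push_cast
    field_simp
  rw [h, Real.exp_nat_mul, Real.exp_log hδ, pow_mul]

variable {P : Measure Ω} [IsProbabilityMeasure P] {ν : Fin (n + 1) → Measure ℝ}
  {X : Draw n → Ω → ℝ}

theorem IsSampling.empMean_tails (h : IsSampling ν X P) {i : Fin (n + 1)} {d : ℕ → Draw n}
    (hd : Function.Injective d) (hi : ∀ t, (d t).arm = i) (m : ℕ) {e : ℝ} (he : 0 ≤ e) :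
    P {ω | armMean ν i + e ≤ empMean (fun t => X (d t) ω) m} ≤
        ENNReal.ofReal (Real.exp (-(2 * (m * e ^ 2)))) ∧
      P {ω | empMean (fun t => X (d t) ω) m ≤ armMean ν i - e} ≤
        ENNReal.ofReal (Real.exp (-(2 * (m * e ^ 2)))) := by
  have := h.prob i
  exact measure_empMean_deviation_le (h.mem_Icc i) (fun t => h.measurable (d t))
    (fun t => by rw [h.map_eq, hi]) (h.indep.precomp hd) m he

theorem IsSampling.muHat_tails (h : IsSampling ν X P) {δ : ℝ} (hδ : 0 < δ) (hδ1 : δ < 1) (ℓ : ℕ)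
    (i : Fin (n + 1)) :
    P {ω | armMean ν i + phaseEps δ ℓ ≤ muHat (fun d => X d ω) ℓ i} ≤
        ENNReal.ofReal ((δ ^ 2) ^ ℓ) ∧
      P {ω | muHat (fun d => X d ω) ℓ i ≤ armMean ν i - phaseEps δ ℓ} ≤
        ENNReal.ofReal ((δ ^ 2) ^ ℓ) := by
  rw [← exp_phasePulls hδ hδ1]
  exact h.empMean_tails (d := fun t => .est ℓ i t) (fun t t' htt => by cases htt; rfl)
    (fun _ => rfl) _ (phaseEps_pos hδ hδ1 ℓ).le

theorem exp_mePulls_le {ε η : ℝ} (hε : 0 < ε) (hη : 0 < η) (r : ℕ) :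
    Real.exp (-(2 * (mePulls ε η r * (meEps ε r / 2) ^ 2))) ≤ (meConf η r / 3) ^ 2 := by
  have he : 0 < (meEps ε r / 2) ^ 2 := by unfold meEps; positivity
  have hc : 0 < meConf η r := by unfold meConf; positivity
  have h1 : Real.log (3 / meConf η r) ≤ mePulls ε η r * (meEps ε r / 2) ^ 2 := by
    have h2 := Nat.le_ceil (1 / (meEps ε r / 2) ^ 2 * Real.log (3 / meConf η r))
    rw [one_div_mul_eq_div, div_le_iff₀ he] at h2
    rw [mePulls, one_div_mul_eq_div]
    exact h2
  have h3 : (meConf η r / 3) ^ 2 = Real.exp (-(2 * Real.log (3 / meConf η r))) := by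
    have h4 : -(2 * Real.log (3 / meConf η r)) = ((2 : ℕ) : ℝ) * Real.log (meConf η r / 3) := by
      rw [← inv_div, Real.log_inv]
      push_cast
      ring
    rw [h4, Real.exp_nat_mul, Real.exp_log (by positivity)]
  rw [h3]
  exact Real.exp_le_exp.2 (by linarith)

theorem IsSampling.misleading_le (h : IsSampling ν X P) {ε η : ℝ} (hε : 0 < ε) (hη : 0 < η)
    (hη1 : η ≤ 1) (ℓ r : ℕ) (S : Finset (Fin (n + 1))) :
    P {ω | Misleading (armMean ν)
      (fun a => empMean (fun t => X (.elim ℓ r a t) ω) (mePulls ε η r)) (meEps ε r) S} ≤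
        ENNReal.ofReal (η / 2 / 2 ^ r) := by
  have he : 0 ≤ meEps ε r / 2 := by unfold meEps; positivity
  have htail := fun j => h.empMean_tails (i := j) (d := fun t => .elim ℓ r j t)
    (fun t t' htt => by cases htt; rfl) (fun _ => rfl) (mePulls ε η r) he
  refine (measure_misleading_le (fun a => measurable_empMean (fun t => h.measurable _) _)
    (armMean ν) (meEps ε r) (fun j => (htail j).1) (fun j => (htail j).2) S).trans ?_
  have h3 : (3 : ENNReal) = ENNReal.ofReal 3 := by simp
  rw [h3, ← ENNReal.ofReal_mul (by norm_num)]
  refine ENNReal.ofReal_le_ofReal ?_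
  have h4 : meConf η r = η / 2 / 2 ^ r := by
    unfold meConf
    field_simp
    ring
  have h5 : meConf η r ≤ 1 := by
    unfold meConf
    exact div_le_one_of_le₀ (hη1.trans (one_le_pow₀ (by norm_num))) (by positivity)
  have h6 : 0 ≤ meConf η r := by unfold meConf; positivity
  rw [← h4]
  -- Three tails of size `(η_r / 3)²` add up to `η_r² / 3 ≤ η_r`, as `η_r ≤ 1`.
  nlinarith [exp_mePulls_le hε hη r]

/-- The surviving set of round `r` is determined by earlier draws and the averages of that round by
fresh ones, so round `r` is misleading with probability at most `δ^ℓ / 2^(r+1)`. A union bound over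
rounds gives `δ^ℓ`. -/
theorem IsSampling.le_ref_fails_le (h : IsSampling ν X P) {δ : ℝ} (hδ : 0 < δ) (hδ1 : δ < 1)
    (ℓ : ℕ) :
    P {ω | ¬∀ a ∈ activeSet δ (fun d => X d ω) ℓ, armMean ν a - phaseEps δ ℓ ≤
      armMean ν (phaseRef δ (fun d => X d ω) ℓ (activeSet δ (fun d => X d ω) ℓ))} ≤
        ENNReal.ofReal (δ ^ ℓ) := by
  have hε := phaseEps_pos hδ hδ1 ℓ
  have hη : 0 < δ ^ ℓ := by positivity
  have hη1 : δ ^ ℓ ≤ 1 := pow_le_one₀ hδ.le hδ1.le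
  set B : ℕ → Set Ω := fun r => {ω | Misleading (armMean ν)
    (fun a => empMean (fun t => X (.elim ℓ r a t) ω) (mePulls (phaseEps δ ℓ) (δ ^ ℓ) r))
    (meEps (phaseEps δ ℓ) r) (meSet (activeSet δ (fun d => X d ω) ℓ) (phaseEps δ ℓ) (δ ^ ℓ)
      (fun r i t => X (.elim ℓ r i t) ω) r)} with hB
  have hsub : {ω | ¬∀ a ∈ activeSet δ (fun d => X d ω) ℓ, armMean ν a - phaseEps δ ℓ ≤
      armMean ν (phaseRef δ (fun d => X d ω) ℓ (activeSet δ (fun d => X d ω) ℓ))} ⊆ ⋃ r, B r := by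
    intro ω hω
    by_contra hcon
    simp only [Set.mem_iUnion, not_exists] at hcon
    exact hω fun a ha => le_meOutput _ _ _ _ hε.le hcon ha
  have hround : ∀ r, P (B r) ≤ ENNReal.ofReal (δ ^ ℓ / 2 / 2 ^ r) := fun r =>
    measure_random_index_le h.measurable h.indep (disjoint_beforeRound ℓ r)
      (f := fun x => meSet (activeSet δ x ℓ) (phaseEps δ ℓ) (δ ^ ℓ)
        (fun r i t => x (.elim ℓ r i t)) r)
      (F := fun S => {x | Misleading (armMean ν)
        (fun a => empMean (fun t => x (.elim ℓ r a t)) (mePulls (phaseEps δ ℓ) (δ ^ ℓ) r))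
        (meEps (phaseEps δ ℓ) r) S})
      (measurableSet_comp_eq (g := fun A x => meSet A (phaseEps δ ℓ) (δ ^ ℓ)
        (fun r i t => x (.elim ℓ r i t)) r) (measurableSet_activeSet_eq δ ℓ)
        (fun A S => measurableSet_meSet_eq (fun _ _ _ => measurable_pi_apply _) A _ _ r S))
      (dependsOn_meSet_activeSet δ _ _ ℓ r)
      (fun S => measurableSet_misleading
        (fun a => measurable_empMean (fun _ => measurable_pi_apply _) _) _ _ S)
      (fun S x x' hx => by
        have : (fun a t => x (.elim ℓ r a t)) = fun a t => x' (.elim ℓ r a t) := by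
          ext a t
          exact hx _ ⟨a, t, rfl⟩
        have h2 := fun a => congrFun this a
        simp only [Set.mem_ofPred_eq, h2])
      (fun S => h.misleading_le hε hη hη1 ℓ r S)
  calc P _ ≤ P (⋃ r, B r) := measure_mono hsub
    _ ≤ ∑' r, P (B r) := measure_iUnion_le _
    _ ≤ ∑' r : ℕ, ENNReal.ofReal (δ ^ ℓ / 2 / 2 ^ r) := ENNReal.tsum_le_tsum hround
    _ = ENNReal.ofReal (δ ^ ℓ) := by
      rw [← ENNReal.ofReal_tsum_of_nonneg (fun r => by positivity) (summable_geometric_two' _),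
        tsum_geometric_two']

/-- The reference arm is chosen before the samples of step (2) are drawn, so a bound valid for each
fixed arm carries over without a union bound. The sets `E i` serve for either tail. -/
theorem IsSampling.ref_deviation_le (h : IsSampling ν X P) {δ : ℝ} (ℓ : ℕ)
    {E : Fin (n + 1) → Set ℝ} (hE : ∀ i, MeasurableSet (E i))
    (hP : ∀ i, P {ω | muHat (fun d => X d ω) ℓ i ∈ E i} ≤ ENNReal.ofReal ((δ ^ 2) ^ ℓ)) :
    P {ω | muHat (fun d => X d ω) ℓ
        (phaseRef δ (fun d => X d ω) ℓ (activeSet δ (fun d => X d ω) ℓ)) ∈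
      E (phaseRef δ (fun d => X d ω) ℓ (activeSet δ (fun d => X d ω) ℓ))} ≤
        ENNReal.ofReal ((δ ^ 2) ^ ℓ) :=
  measure_random_index_le h.measurable h.indep (disjoint_beforeEst ℓ)
    (f := fun x => phaseRef δ x ℓ (activeSet δ x ℓ))
    (F := fun i => {x | muHat x ℓ i ∈ E i})
    (measurableSet_comp_eq (g := fun A x => phaseRef δ x ℓ A) (measurableSet_activeSet_eq δ ℓ)
      (fun A => measurableSet_phaseRef_eq δ ℓ A))
    (dependsOn_phaseRef_activeSet δ ℓ)
    (fun i => measurable_muHat ℓ i (hE i))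
    (fun i x x' hx => by simp only [Set.mem_ofPred_eq, dependsOn_muHat ℓ i hx])
    hP

theorem IsSampling.phase_inaccurate_le (h : IsSampling ν X P) {δ : ℝ} (hδ : 0 < δ) (hδ1 : δ < 1)
    (best : Fin (n + 1)) (ℓ : ℕ) :
    P {ω | ¬PhaseAccurate δ (armMean ν) best (fun d => X d ω) ℓ} ≤
      ENNReal.ofReal (δ ^ ℓ + 3 * (δ ^ 2) ^ ℓ) := by
  have h1 := h.le_ref_fails_le hδ hδ1 ℓ
  have h2 := (h.muHat_tails hδ hδ1 ℓ best).2
  have h3 := h.ref_deviation_le ℓ (E := fun i => Set.Ici (armMean ν i + phaseEps δ ℓ))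
    (fun _ => measurableSet_Ici) (fun i => (h.muHat_tails hδ hδ1 ℓ i).1)
  have h4 := h.ref_deviation_le ℓ (E := fun i => Set.Iic (armMean ν i - phaseEps δ ℓ))
    (fun _ => measurableSet_Iic) (fun i => (h.muHat_tails hδ hδ1 ℓ i).2)
  have hsum : ENNReal.ofReal (δ ^ ℓ + 3 * (δ ^ 2) ^ ℓ) = ENNReal.ofReal (δ ^ ℓ) +
      ENNReal.ofReal ((δ ^ 2) ^ ℓ) + ENNReal.ofReal ((δ ^ 2) ^ ℓ) +
      ENNReal.ofReal ((δ ^ 2) ^ ℓ) := by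
    rw [← ENNReal.ofReal_add, ← ENNReal.ofReal_add, ← ENNReal.ofReal_add]
    · congr 1
      ring
    all_goals positivity
  rw [hsum]
  refine le_trans (measure_mono ?_) ((measure_union_le _ _).trans (add_le_add
    ((measure_union_le _ _).trans (add_le_add ((measure_union_le _ _).trans (add_le_add h1 h2)) h3))
    h4))
  intro ω hω
  by_contra hcon
  simp only [Set.mem_union, Set.mem_ofPred_eq, Set.mem_Ici, Set.mem_Iic, not_or, not_not,
    not_le] at hcon
  exact hω ⟨hcon.1.1.1, hcon.1.1.2, hcon.1.2, hcon.2⟩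

theorem IsSampling.exists_phase_inaccurate_le (h : IsSampling ν X P) {δ : ℝ} (hδ : 0 < δ)
    (hδ1 : δ < 1) (best : Fin (n + 1)) :
    P {ω | ∃ ℓ, 1 ≤ ℓ ∧ ¬PhaseAccurate δ (armMean ν) best (fun d => X d ω) ℓ} ≤
      ENNReal.ofReal (3 * δ ^ 2 / (1 - δ ^ 2) + δ / (1 - δ)) := by
  have hδ2 : δ ^ 2 < 1 := by nlinarith
  have hs1 := (hasSum_geometric_of_lt_one hδ.le hδ1).mul_left δ
  have hs2 := (hasSum_geometric_of_lt_one (by positivity) hδ2).mul_left (3 * δ ^ 2)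
  have hs := hs1.add hs2
  calc P _ ≤ P (⋃ k : ℕ, {ω | ¬PhaseAccurate δ (armMean ν) best (fun d => X d ω) (k + 1)}) := by
        refine measure_mono ?_
        rintro ω ⟨ℓ, hℓ, hω⟩
        refine Set.mem_iUnion.2 ⟨ℓ - 1, ?_⟩
        rw [Nat.sub_add_cancel hℓ]
        exact hω
    _ ≤ ∑' k : ℕ, ENNReal.ofReal (δ * δ ^ k + 3 * δ ^ 2 * (δ ^ 2) ^ k) := by
        refine (measure_iUnion_le _).trans (ENNReal.tsum_le_tsum fun k => ?_)
        refine (h.phase_inaccurate_le hδ hδ1 best (k + 1)).trans (le_of_eq ?_)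
        congr 1
        ring
    _ = _ := by
        rw [← ENNReal.ofReal_tsum_of_nonneg (fun k => by positivity) hs.summable, hs.tsum_eq]
        congr 1
        ring

/-- The weighted number of phases in which the arms other than `best` are overestimated. -/
noncomputable def overestimation (δ : ℝ) (μ : Fin (n + 1) → ℝ) (best : Fin (n + 1))
    (x : Draw n → ℝ) : ENNReal :=
  ∑ i ∈ Finset.univ.erase best, ∑' k : ℕ,
    {x | μ i + phaseEps δ (k + 1) ≤ muHat x (k + 1) i}.indicator
      (fun _ => (phasePulls (k + 2) : ENNReal)) x

/-- Index `k` stands for phase `k + 1`, and the weight is the cost of phase `k + 2`, which the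
overestimated arm may reach. As `k + 2 ≤ 2 · 2^k`, the expected weight is at most `8 δ² (4 δ²)^k`,
and `4 δ² ≤ 1/3` bounds the sum by `8 δ² · 3/2`. -/
theorem IsSampling.lintegral_overestimation_le (h : IsSampling ν X P) {δ : ℝ} (hδ : 0 < δ)
    (hδ1 : δ ≤ 7 / 25) (best : Fin (n + 1)) :
    ∫⁻ ω, overestimation δ (armMean ν) best (fun d => X d ω) ∂P ≤
      n * ENNReal.ofReal (12 * δ ^ 2) := by
  have hmeas : ∀ i k, MeasurableSet
      {ω | armMean ν i + phaseEps δ (k + 1) ≤ muHat (fun d => X d ω) (k + 1) i} := fun i k =>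
    measurableSet_le measurable_const
      ((measurable_muHat _ i).comp (measurable_pi_lambda _ h.measurable))
  have hind : ∀ i k ω,
      {x | armMean ν i + phaseEps δ (k + 1) ≤ muHat x (k + 1) i}.indicator
        (fun _ => (phasePulls (k + 2) : ENNReal)) (fun d => X d ω) =
      {ω | armMean ν i + phaseEps δ (k + 1) ≤ muHat (fun d => X d ω) (k + 1) i}.indicator
        (fun _ => (phasePulls (k + 2) : ENNReal)) ω := fun i k ω => rfl
  have hgeom : ∑' k : ℕ, ENNReal.ofReal (8 * δ ^ 2 * (4 * δ ^ 2) ^ k) ≤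
      ENNReal.ofReal (12 * δ ^ 2) := by
    have h4 : 4 * δ ^ 2 ≤ 1 / 3 := by nlinarith
    have hs := (hasSum_geometric_of_lt_one (r := 4 * δ ^ 2) (by positivity)
      (by linarith)).mul_left (8 * δ ^ 2)
    rw [← ENNReal.ofReal_tsum_of_nonneg (fun k => by positivity) hs.summable, hs.tsum_eq]
    refine ENNReal.ofReal_le_ofReal ?_
    rw [← div_eq_mul_inv, div_le_iff₀ (by linarith)]
    nlinarith [sq_nonneg δ]
  unfold overestimation
  simp only [hind]
  rw [lintegral_finsetSum _ fun i _ => Measurable.tsum fun k =>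
    measurable_const.indicator (hmeas i k)]
  calc _ ≤ ∑ i ∈ Finset.univ.erase best, ENNReal.ofReal (12 * δ ^ 2) := by
        refine Finset.sum_le_sum fun i _ => ?_
        rw [lintegral_tsum fun k => (measurable_const.indicator (hmeas i k)).aemeasurable]
        refine (ENNReal.tsum_le_tsum fun k => ?_).trans hgeom
        rw [lintegral_indicator (hmeas i k), lintegral_const, Measure.restrict_apply_univ]
        refine (mul_le_mul_right (h.muHat_tails hδ (by linarith) (k + 1) i).1 _).trans ?_
        rw [← ENNReal.ofReal_natCast, ← ENNReal.ofReal_mul (by positivity)]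
        refine ENNReal.ofReal_le_ofReal ?_
        have hk : ((k + 2 : ℕ) : ℝ) ≤ 2 * 2 ^ k := by
          have : k + 2 ≤ 2 * 2 ^ k := by
            have := k.lt_two_pow_self
            rcases k with _ | k
            · simp
            · rw [pow_succ] at *
              omega
          exact_mod_cast this
        unfold phasePulls
        push_cast at hk ⊢
        calc ((k : ℝ) + 2) * 2 ^ (k + 2) * (δ ^ 2) ^ (k + 1)
            ≤ (2 * 2 ^ k) * 2 ^ (k + 2) * (δ ^ 2) ^ (k + 1) := by gcongr
          _ = 8 * δ ^ 2 * (4 * δ ^ 2) ^ k := by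
            have : (4 : ℝ) ^ k = 2 ^ k * 2 ^ k := by
              rw [← mul_pow]
              norm_num
            rw [mul_pow 4, this]
            ring
    _ = n * ENNReal.ofReal (12 * δ ^ 2) := by
        rw [Finset.sum_const, Finset.card_erase_of_mem (Finset.mem_univ _), Finset.card_univ,
          Fintype.card_fin, nsmul_eq_mul]
        simp

theorem IsSampling.overestimation_ge_le (h : IsSampling ν X P) {δ : ℝ} (hδ : 0 < δ)
    (hδ1 : δ ≤ 7 / 25) (best : Fin (n + 1)) (hn : n ≠ 0) :
    P {ω | (3 * n : ENNReal) ≤ overestimation δ (armMean ν) best (fun d => X d ω)} ≤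
      ENNReal.ofReal (4 * δ ^ 2) := by
  have hm : Measurable fun ω => overestimation δ (armMean ν) best (fun d => X d ω) := by
    unfold overestimation
    refine Finset.measurable_fun_sum _ fun i _ => Measurable.tsum fun k => ?_
    exact (measurable_const.indicator (measurableSet_le measurable_const
      (measurable_muHat _ i))).comp (measurable_pi_lambda _ h.measurable)
  have h1 := (mul_meas_ge_le_lintegral hm (3 * n)).trans
    (h.lintegral_overestimation_le hδ hδ1 best)
  have h2 : (n : ENNReal) * ENNReal.ofReal (12 * δ ^ 2) =
      3 * n * ENNReal.ofReal (4 * δ ^ 2) := by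
    have h3 : ENNReal.ofReal (12 * δ ^ 2) = 3 * ENNReal.ofReal (4 * δ ^ 2) := by
      rw [← ENNReal.ofReal_ofNat 3, ← ENNReal.ofReal_mul (by norm_num)]
      congr 1
      ring
    rw [h3]
    ring
  rw [h2] at h1
  refine (ENNReal.mul_le_mul_iff_right ?_ ?_).1 h1
  · simpa using hn
  · exact ENNReal.mul_ne_top (by simp) (by simp)

end Probability

/-! ### Sample count when all phases are accurate -/

section Analysis

/-- Take the least admissible `L`, with `lam` in the role of `log(1/δ)`; the `25 = 5²` matches gaps
above `5 ε_ℓ`. Minimality gives `2^L ≤ 50 lam / Δ²`, and taking logarithms bounds `L`; `1900 = 38 ·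
50`. -/
theorem exists_level {lam Δ : ℝ} (hlam : 6 / 5 ≤ lam) (hΔ : 0 < Δ) (hΔ1 : Δ ≤ 1) :
    ∃ L : ℕ, 1 ≤ L ∧ 25 * lam / Δ ^ 2 < 2 ^ L ∧ (L * 2 ^ L : ℝ) ≤
      1900 * (lam * (1 / Δ ^ 2 * Real.log lam + 1 / Δ ^ 2 * Real.logb 2 (1 / Δ ^ 2))) := by
  classical
  have hlam0 : 0 < lam := by linarith
  have hex : ∃ L : ℕ, 25 * lam / Δ ^ 2 < 2 ^ L := pow_unbounded_of_one_lt _ (by norm_num)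
  have hD : 1 ≤ 1 / Δ ^ 2 := by
    rw [le_div_iff₀ (by positivity)]
    nlinarith
  have heq : 25 * lam / Δ ^ 2 = 25 * lam * (1 / Δ ^ 2) := by ring
  have hL1 : 1 ≤ Nat.find hex := by
    by_contra! h
    have h0 := Nat.find_spec hex
    rw [Nat.lt_one_iff.1 h, heq] at h0
    nlinarith
  obtain ⟨k, hk⟩ := Nat.exists_eq_add_of_le' hL1
  have hprev : (2 : ℝ) ^ k ≤ 25 * lam / Δ ^ 2 :=
    not_lt.1 (Nat.find_min hex (by omega))
  refine ⟨Nat.find hex, hL1, Nat.find_spec hex, ?_⟩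
  rw [hk]
  have hpow : (2 : ℝ) ^ (k + 1) ≤ 50 * lam * (1 / Δ ^ 2) := by
    rw [pow_succ]
    linarith
  have hloglam : 1 / 6 ≤ Real.log lam := by
    have h1 := Real.one_sub_inv_le_log_of_pos hlam0
    have h2 : lam⁻¹ ≤ (6 / 5)⁻¹ := by gcongr
    norm_num at h2
    linarith
  have hlogb : 0 ≤ Real.logb 2 (1 / Δ ^ 2) := Real.logb_nonneg (by norm_num) hD
  -- The constant `log₂ 50 ≤ 6` is at most `36 log lam` because `log lam ≥ 1/6`, and `log₂ lam ≤ 2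
  -- log lam`.
  have hlevel : ((k + 1 : ℕ) : ℝ) ≤ 38 * (Real.log lam + Real.logb 2 (1 / Δ ^ 2)) := by
    have h1 : ((k + 1 : ℕ) : ℝ) ≤ Real.logb 2 (50 * lam * (1 / Δ ^ 2)) := by
      rw [Real.le_logb_iff_rpow_le (by norm_num) (by positivity), Real.rpow_natCast]
      exact hpow
    rw [Real.logb_mul (by positivity) (by positivity), Real.logb_mul (by norm_num) hlam0.ne'] at h1
    have h2 : Real.logb 2 50 ≤ 6 := by
      rw [Real.logb_le_iff_le_rpow (by norm_num) (by norm_num)]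
      norm_num
    have h3 : Real.logb 2 lam ≤ 2 * Real.log lam := by
      unfold Real.logb
      rw [div_le_iff₀ (Real.log_pos (by norm_num))]
      nlinarith [Real.log_two_gt_d9]
    linarith
  calc ((k + 1 : ℕ) : ℝ) * 2 ^ (k + 1)
      ≤ 38 * (Real.log lam + Real.logb 2 (1 / Δ ^ 2)) * (50 * lam * (1 / Δ ^ 2)) := by gcongr
    _ = _ := by ring

theorem sum_phasePulls_le (L : ℕ) : ∑ ℓ ∈ Finset.range (L + 1), phasePulls ℓ ≤ 2 * phasePulls L := by
  induction L with
  | zero => simp [phasePulls]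
  | succ L ih =>
    rw [Finset.sum_range_succ]
    have : 2 * phasePulls L ≤ phasePulls (L + 1) := by
      unfold phasePulls
      rw [pow_succ]
      nlinarith [Nat.zero_le (2 ^ L)]
    omega

variable {n : ℕ} {δ : ℝ} {μ : Fin (n + 1) → ℝ} {best : Fin (n + 1)} {x : Draw n → ℝ}

theorem activeSet_succ (δ : ℝ) (x : Draw n → ℝ) {ℓ : ℕ} (hℓ : 1 ≤ ℓ) :
    activeSet δ x (ℓ + 1) = phaseNext δ x ℓ (activeSet δ x ℓ) := by
  obtain ⟨k, rfl⟩ := Nat.exists_eq_add_of_le' hℓ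
  rfl

theorem best_mem_activeSet (hacc : ∀ ℓ, 1 ≤ ℓ → PhaseAccurate δ μ best x ℓ)
    (hbest : ∀ i, μ i ≤ μ best) {ℓ : ℕ} (hℓ : 1 ≤ ℓ) : best ∈ activeSet δ x ℓ := by
  induction ℓ, hℓ using Nat.le_induction with
  | base => exact Finset.mem_univ _
  | succ ℓ hℓ ih =>
    rw [activeSet_succ δ x hℓ]
    refine Finset.mem_filter.2 ⟨ih, ?_⟩
    have h := hacc ℓ hℓ
    have h1 := h.lt_best
    have h2 := h.ref_lt
    have h3 := hbest (phaseRef δ x ℓ (activeSet δ x ℓ))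
    -- `muHat best > μ best - ε ≥ μ ref - ε > muHat ref - 2ε`.
    linarith

/-- An arm that is far from optimal survives an accurate phase only if it is overestimated. -/
theorem overestimated_of_mem_activeSet (hacc : ∀ ℓ, 1 ≤ ℓ → PhaseAccurate δ μ best x ℓ)
    (hbest : ∀ i, μ i ≤ μ best) {ℓ : ℕ} (hℓ : 1 ≤ ℓ) {i : Fin (n + 1)}
    (hgap : 5 * phaseEps δ ℓ < μ best - μ i) (hi : i ∈ activeSet δ x (ℓ + 1)) :
    μ i + phaseEps δ ℓ ≤ muHat x ℓ i := by
  rw [activeSet_succ δ x hℓ] at hi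
  have h1 := (Finset.mem_filter.1 hi).2
  have h2 := (hacc ℓ hℓ).le_ref best (best_mem_activeSet hacc hbest hℓ)
  have h3 := (hacc ℓ hℓ).lt_ref
  -- `muHat i ≥ muHat ref - 2ε > μ ref - 3ε ≥ μ best - 4ε > μ i + ε`.
  linarith

theorem five_mul_phaseEps_lt (hδ : 0 < δ) (hδ1 : δ < 1) {Δ : ℝ} (hΔ : 0 < Δ) {L ℓ : ℕ}
    (hL : 25 * Real.log (1 / δ) / Δ ^ 2 < 2 ^ L) (hℓ : L ≤ ℓ) : 5 * phaseEps δ ℓ < Δ := by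
  refine lt_of_pow_lt_pow_left₀ 2 hΔ.le ?_
  rw [mul_pow, phaseEps_sq hδ hδ1, ← mul_div_assoc, div_lt_iff₀ (by positivity)]
  rw [div_lt_iff₀ (by positivity)] at hL
  have : (2 : ℝ) ^ L ≤ 2 ^ ℓ := pow_le_pow_right₀ (by norm_num) hℓ
  nlinarith [sq_nonneg Δ]

/-- Here `Q = n_ℓ` works because `1/ε_ℓ² = 2^ℓ / log(1/δ)` and `log(1/δ^ℓ) = ℓ log(1/δ) ≥ 1`, which
absorbs the additive `2 + r`. Step (2) costs `|A| n_ℓ ≤ 2 (|A| - 1) n_ℓ`, raising `12870` to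
`12872`. -/
theorem phaseSamples_le (hδ : 0 < δ) (hlam : 1 ≤ Real.log (1 / δ)) {ℓ : ℕ} (hℓ : 1 ≤ ℓ)
    {A : Finset (Fin (n + 1))} (hA : 2 ≤ A.card) :
    (phaseSamples δ x ℓ A : ℝ) ≤ 12872 * (phasePulls ℓ * (A.card - 1)) := by
  have hδ1 : δ < 1 := by
    by_contra! h
    have := Real.log_nonpos (x := 1 / δ) (by positivity) (by rw [div_le_iff₀ hδ]; linarith)
    linarith
  have hℓ' : (1 : ℝ) ≤ ℓ := by exact_mod_cast hℓ
  have hA' : (2 : ℝ) ≤ A.card := by exact_mod_cast hA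
  have hQ : (1 : ℝ) ≤ phasePulls ℓ := by
    unfold phasePulls
    exact_mod_cast Nat.one_le_iff_ne_zero.2 (mul_ne_zero (by omega) (by positivity))
  have hme := meSamples_le (y := fun r i t => x (.elim ℓ r i t)) (Finset.card_pos.1 (by omega))
    (phaseEps_pos hδ hδ1 ℓ) (η := δ ^ ℓ) (by positivity) hQ (A := A) fun r => by
      have hr : (0 : ℝ) ≤ r := Nat.cast_nonneg r
      rw [phaseEps_sq hδ hδ1, one_div_div, phasePulls, ← one_div_pow, Real.log_pow]
      push_cast
      rw [div_mul_eq_mul_div, div_le_iff₀ (by linarith)]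
      have h1 : ℓ * Real.log (1 / δ) + 2 + r ≤ ℓ * (3 + r) * Real.log (1 / δ) := by
        have h2 : (2 + r : ℝ) ≤ (2 + r) * (ℓ * Real.log (1 / δ)) :=
          le_mul_of_one_le_right (by linarith) (one_le_mul_of_one_le_of_one_le hℓ' hlam)
        linarith
      calc (2 : ℝ) ^ ℓ * (ℓ * Real.log (1 / δ) + 2 + r)
          ≤ 2 ^ ℓ * (ℓ * (3 + r) * Real.log (1 / δ)) := by gcongr
        _ = _ := by ring
  unfold phaseSamples
  push_cast
  have : (A.card : ℝ) * phasePulls ℓ ≤ 2 * (A.card - 1) * phasePulls ℓ := by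
    gcongr
    linarith
  linarith

-- As the best arm is always active, `|A_ℓ| - 1` counts the other active arms. Exchanging the sums
-- charges the cost of each phase to these arms.
open Classical in
theorem samplesBefore_le (hδ : 0 < δ) (hlam : 1 ≤ Real.log (1 / δ))
    (hmem : ∀ ℓ, 1 ≤ ℓ → best ∈ activeSet δ x ℓ) {M : ℕ}
    (hM : ∀ ℓ, 1 ≤ ℓ → ℓ < M → (activeSet δ x ℓ).card ≠ 1) :
    (samplesBefore δ x M : ℝ) ≤ 12872 * ((∑ i ∈ Finset.univ.erase best, ∑ ℓ ∈ Finset.Ico 1 M,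
      if i ∈ activeSet δ x ℓ then phasePulls ℓ else 0 : ℕ) : ℝ) := by
  rw [Finset.sum_comm]
  unfold samplesBefore
  push_cast
  rw [Finset.mul_sum]
  refine Finset.sum_le_sum fun ℓ hℓ => ?_
  obtain ⟨hℓ1, hℓM⟩ := Finset.mem_Ico.1 hℓ
  have hb := hmem ℓ hℓ1
  have hcard : 2 ≤ (activeSet δ x ℓ).card := by
    have h1 := Finset.card_pos.2 ⟨best, hb⟩
    have h2 := hM ℓ hℓ1 hℓM
    omega
  refine (phaseSamples_le hδ hlam hℓ1 hcard).trans (le_of_eq ?_)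
  congr 1
  rw [← Finset.sum_filter, Finset.sum_const, nsmul_eq_mul, mul_comm]
  congr 1
  have h3 : ({i ∈ Finset.univ.erase best | i ∈ activeSet δ x ℓ} : Finset (Fin (n + 1))) =
      (activeSet δ x ℓ).erase best := by
    ext i
    simp
  rw [h3, Finset.card_erase_of_mem hb, Nat.cast_sub (by omega)]
  simp

-- Phases up to `L` are summed geometrically. An arm active in a phase `ℓ > L` survived phase `ℓ - 1
-- ≥ L`, where its gap already exceeds `5 ε_{ℓ-1}`, so it was overestimated there.
open Classical in
theorem sum_active_le (hδ : 0 < δ) (hδ1 : δ < 1)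
    (hacc : ∀ ℓ, 1 ≤ ℓ → PhaseAccurate δ μ best x ℓ) (hbest : ∀ i, μ i ≤ μ best)
    {i : Fin (n + 1)} (hi : μ i < μ best) {L : ℕ} (hL1 : 1 ≤ L)
    (hL : 25 * Real.log (1 / δ) / (μ best - μ i) ^ 2 < 2 ^ L) (M : ℕ) :
    (∑ ℓ ∈ Finset.Ico 1 M, if i ∈ activeSet δ x ℓ then phasePulls ℓ else 0) ≤
      2 * phasePulls L + ∑ k ∈ Finset.range M,
        if μ i + phaseEps δ (k + 1) ≤ muHat x (k + 1) i then phasePulls (k + 2) else 0 := by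
  -- The guard `2 ≤ ℓ` makes `v` vanish at `0` and `1`, so that shifting by two turns `ℓ` into `k +
  -- 2`.
  set v : ℕ → ℕ := fun ℓ =>
    if 2 ≤ ℓ ∧ μ i + phaseEps δ (ℓ - 1) ≤ muHat x (ℓ - 1) i then phasePulls ℓ else 0 with hv
  have hterm : ∀ ℓ ∈ Finset.Ico 1 M, (if i ∈ activeSet δ x ℓ then phasePulls ℓ else 0) ≤
      (if ℓ ∈ Finset.range (L + 1) then phasePulls ℓ else 0) + v ℓ := by
    intro ℓ _
    by_cases hmem : i ∈ activeSet δ x ℓ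
    · by_cases hℓ : ℓ ∈ Finset.range (L + 1)
      · simp [hmem, hℓ]
      · have hℓ' : L < ℓ := by simpa using hℓ
        obtain ⟨m, rfl⟩ : ∃ m, ℓ = m + 1 := ⟨ℓ - 1, by omega⟩
        have h := overestimated_of_mem_activeSet hacc hbest (ℓ := m) (by omega)
          (five_mul_phaseEps_lt hδ hδ1 (by linarith) hL (by omega)) hmem
        have hvm : v (m + 1) = phasePulls (m + 1) := by
          simp [hv, h, show 1 ≤ m by omega]
        rw [if_pos hmem, if_neg hℓ, hvm]
        omega
    · simp [hmem]
  refine (Finset.sum_le_sum hterm).trans ?_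
  rw [Finset.sum_add_distrib]
  refine add_le_add ?_ ?_
  · rw [← Finset.sum_filter]
    refine (Finset.sum_le_sum_of_subset ?_).trans (sum_phasePulls_le L)
    intro ℓ hℓ
    exact (Finset.mem_filter.1 hℓ).2
  · calc ∑ ℓ ∈ Finset.Ico 1 M, v ℓ ≤ ∑ ℓ ∈ Finset.range (M + 2), v ℓ := by
          refine Finset.sum_le_sum_of_subset fun ℓ hℓ => ?_
          have := (Finset.mem_Ico.1 hℓ).2
          exact Finset.mem_range.2 (by omega)
      _ = _ := by
          rw [Finset.sum_range_succ', Finset.sum_range_succ']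
          simp [hv]

open Classical in
theorem sum_overestimated_le_overestimation (δ : ℝ) (μ : Fin (n + 1) → ℝ) (best : Fin (n + 1))
    (x : Draw n → ℝ) (M : ℕ) :
    ((∑ i ∈ Finset.univ.erase best, ∑ k ∈ Finset.range M,
      if μ i + phaseEps δ (k + 1) ≤ muHat x (k + 1) i then phasePulls (k + 2) else 0 : ℕ) :
        ENNReal) ≤ overestimation δ μ best x := by
  unfold overestimation
  push_cast
  refine Finset.sum_le_sum fun i _ => le_trans (le_of_eq ?_) (ENNReal.sum_le_tsum (Finset.range M))
  refine Finset.sum_congr rfl fun k _ => ?_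
  simp [Set.indicator_apply]

theorem sub_one_le_samplesBefore (hmem : ∀ ℓ, 1 ≤ ℓ → best ∈ activeSet δ x ℓ) (M : ℕ) :
    M - 1 ≤ samplesBefore δ x M := by
  unfold samplesBefore
  calc M - 1 = ∑ ℓ ∈ Finset.Ico 1 M, 1 := by simp
    _ ≤ _ := by
      refine Finset.sum_le_sum fun ℓ hℓ => ?_
      have hℓ1 := (Finset.mem_Ico.1 hℓ).1
      have h1 := Finset.card_pos.2 ⟨best, hmem ℓ hℓ1⟩
      have h2 : 0 < phasePulls ℓ := Nat.mul_pos hℓ1 (by positivity)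
      have h3 : 0 < (activeSet δ x ℓ).card * phasePulls ℓ := Nat.mul_pos h1 h2
      unfold phaseSamples
      omega

theorem stopsWithin_of_accurate (hδ : 0 < δ) (hlam : 1 ≤ Real.log (1 / δ)) (hδ1 : δ < 1)
    (hacc : ∀ ℓ, 1 ≤ ℓ → PhaseAccurate δ μ best x ℓ) (hbest : ∀ i, i ≠ best → μ i < μ best)
    {L : Fin (n + 1) → ℕ} (hL1 : ∀ i, i ≠ best → 1 ≤ L i)
    (hL : ∀ i, i ≠ best → 25 * Real.log (1 / δ) / (μ best - μ i) ^ 2 < 2 ^ L i)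
    (hover : overestimation δ μ best x ≤ 3 * n) :
    StopsWithin δ x best
      (51488 * ∑ i ∈ Finset.univ.erase best, (L i * 2 ^ L i : ℝ)) := by
  classical
  have hbest' : ∀ i, μ i ≤ μ best := fun i => by
    rcases eq_or_ne i best with rfl | h
    · exact le_rfl
    · exact (hbest i h).le
  have hmem : ∀ ℓ, 1 ≤ ℓ → best ∈ activeSet δ x ℓ := fun ℓ hℓ => best_mem_activeSet hacc hbest' hℓ
  have hbound : ∀ M, (∀ ℓ, 1 ≤ ℓ → ℓ < M → (activeSet δ x ℓ).card ≠ 1) →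
      (samplesBefore δ x M : ℝ) ≤
        51488 * ∑ i ∈ Finset.univ.erase best, (L i * 2 ^ L i : ℝ) := by
    intro M hM
    have hsum : (∑ i ∈ Finset.univ.erase best, ∑ ℓ ∈ Finset.Ico 1 M,
        if i ∈ activeSet δ x ℓ then phasePulls ℓ else 0) ≤
        4 * ∑ i ∈ Finset.univ.erase best, phasePulls (L i) := by
      have h1 := sum_overestimated_le_overestimation δ μ best x M
      have h2 := h1.trans hover
      have h3 : (∑ i ∈ Finset.univ.erase best, ∑ k ∈ Finset.range M,
          if μ i + phaseEps δ (k + 1) ≤ muHat x (k + 1) i then phasePulls (k + 2) else 0) ≤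
          3 * n := by
        exact_mod_cast h2
      have h4 : 3 * n = ∑ i ∈ Finset.univ.erase best, 3 := by
        rw [Finset.sum_const, Finset.card_erase_of_mem (Finset.mem_univ _), Finset.card_univ,
          Fintype.card_fin]
        simp [mul_comm]
      -- Since `L i ≥ 1`, `2 n_{L i} ≥ 4`, so the budget `3n` is dominated by a second copy of the
      -- main term. This gives the factor `4`, and `51488 = 4 · 12872`.
      have h5 : (∑ i ∈ Finset.univ.erase best, 3) ≤
          ∑ i ∈ Finset.univ.erase best, 2 * phasePulls (L i) := by
        refine Finset.sum_le_sum fun i hi => ?_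
        have h6 := hL1 i (Finset.ne_of_mem_erase hi)
        have h7 : 2 ^ 1 ≤ 2 ^ L i := Nat.pow_le_pow_right (by norm_num) h6
        have h8 := Nat.mul_le_mul h6 h7
        unfold phasePulls
        omega
      have h9 := Finset.sum_le_sum fun i (hi : i ∈ Finset.univ.erase best) =>
        sum_active_le hδ hδ1 hacc hbest' (hbest i (Finset.ne_of_mem_erase hi))
          (hL1 i (Finset.ne_of_mem_erase hi)) (hL i (Finset.ne_of_mem_erase hi)) M
      rw [Finset.sum_add_distrib] at h9
      have h10 : 4 * ∑ i ∈ Finset.univ.erase best, phasePulls (L i) =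
          ∑ i ∈ Finset.univ.erase best, 2 * phasePulls (L i) +
            ∑ i ∈ Finset.univ.erase best, 2 * phasePulls (L i) := by
        rw [← Finset.mul_sum]
        ring
      omega
    have h := samplesBefore_le hδ hlam hmem hM
    have hsum' : ((∑ i ∈ Finset.univ.erase best, ∑ ℓ ∈ Finset.Ico 1 M,
        if i ∈ activeSet δ x ℓ then phasePulls ℓ else 0 : ℕ) : ℝ) ≤
        4 * ∑ i ∈ Finset.univ.erase best, (L i * 2 ^ L i : ℝ) := by
      refine (Nat.cast_le.2 hsum).trans (le_of_eq ?_)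
      simp [phasePulls]
    linarith
  -- If no phase had a singleton set, the bound would hold for every `M`, although at least one
  -- sample is drawn per phase.
  have hsingle : ∃ ℓ, 1 ≤ ℓ ∧ (activeSet δ x ℓ).card = 1 := by
    by_contra! hcon
    obtain ⟨M, hM⟩ := exists_nat_gt
      (51488 * ∑ i ∈ Finset.univ.erase best, (L i * 2 ^ L i : ℝ))
    have h1 := hbound (M + 1) fun ℓ hℓ _ => hcon ℓ hℓ
    have h2 : ((M + 1 - 1 : ℕ) : ℝ) ≤ samplesBefore δ x (M + 1) := by
      exact_mod_cast sub_one_le_samplesBefore hmem (M + 1)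
    rw [Nat.add_sub_cancel] at h2
    linarith
  obtain ⟨h1, hcard⟩ := Nat.find_spec hsingle
  have hmin : ∀ ℓ, 1 ≤ ℓ → ℓ < Nat.find hsingle → (activeSet δ x ℓ).card ≠ 1 :=
    fun ℓ hℓ hlt hc => Nat.find_min hsingle hlt ⟨hℓ, hc⟩
  refine ⟨Nat.find hsingle, ⟨h1, hcard, hmin⟩, ?_, hbound _ hmin⟩
  obtain ⟨a, ha⟩ := Finset.card_eq_one.1 hcard
  have := hmem _ h1
  rw [ha, Finset.mem_singleton] at this
  rw [ha, this]

end Analysis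

/-! ### Range of `δ` and assembly of the bounds -/

section Main

theorem armMean_mem_Icc {n : ℕ} {ν : Fin (n + 1) → Measure ℝ} {i : Fin (n + 1)}
    [IsProbabilityMeasure (ν i)] (hν : ∀ᵐ z ∂(ν i), z ∈ Set.Icc (0 : ℝ) 1) :
    armMean ν i ∈ Set.Icc (0 : ℝ) 1 := by
  refine ⟨integral_nonneg_of_ae (hν.mono fun z hz => hz.1), ?_⟩
  calc armMean ν i ≤ ∫ _, (1 : ℝ) ∂(ν i) := by
        refine integral_mono_of_nonneg (hν.mono fun z hz => hz.1) (integrable_const _)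
          (hν.mono fun z hz => hz.2)
    _ = 1 := by simp

theorem six_fifths_le_log {δ : ℝ} (hδ : 0 < δ) (hδ1 : δ ≤ 7 / 25) : 6 / 5 ≤ Real.log (1 / δ) := by
  rw [Real.le_log_iff_exp_le (by positivity)]
  have h1 : Real.exp (6 / 5) ≤ 25 / 7 := by
    refine le_of_pow_le_pow_left₀ (n := 5) (by norm_num) (by norm_num) ?_
    have h2 : Real.exp (6 / 5) ^ 5 = Real.exp 1 ^ 6 := by
      rw [← Real.exp_nat_mul, ← Real.exp_nat_mul]
      norm_num
    rw [h2]
    calc Real.exp 1 ^ 6 ≤ (2.7182818286 : ℝ) ^ 6 := by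
          gcongr
          exact Real.exp_one_lt_d9.le
      _ ≤ _ := by norm_num
  refine h1.trans ?_
  rw [le_div_iff₀ hδ]
  linarith

/-- Every subtracted term increases with `δ`, and at `7/25` they already total slightly more than
`1`. -/
theorem confidence_nonpos {δ : ℝ} (hδ : 7 / 25 < δ) (hδ1 : δ < 1) :
    1 - 3 * δ ^ 2 / (1 - δ ^ 2) - δ / (1 - δ) - 4 * δ ^ 2 / (1 - δ ^ 2) ^ 2 ≤ 0 := by
  have h0 : (7 / 25 : ℝ) ^ 2 ≤ δ ^ 2 := by gcongr
  have h1 : 0 < 1 - δ ^ 2 := by nlinarith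
  have h2 : 1 - δ ^ 2 ≤ 1 - (7 / 25) ^ 2 := by linarith
  have h3 : 3 * (7 / 25) ^ 2 / (1 - (7 / 25) ^ 2) ≤ 3 * δ ^ 2 / (1 - δ ^ 2) := by gcongr
  have h4 : (7 / 25) / (1 - 7 / 25) ≤ δ / (1 - δ) := by
    have : 0 < 1 - δ := by linarith
    gcongr
  have h5 : 4 * (7 / 25) ^ 2 / (1 - (7 / 25) ^ 2) ^ 2 ≤ 4 * δ ^ 2 / (1 - δ ^ 2) ^ 2 := by gcongr
  norm_num at h3 h4 h5
  linarith

variable {n : ℕ} {Ω : Type*} [MeasurableSpace Ω] {P : Measure Ω} [IsProbabilityMeasure P]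
  {ν : Fin (n + 1) → Measure ℝ} {X : Draw n → Ω → ℝ}

theorem IsSampling.stopsWithin_ge (h : IsSampling ν X P) {δ : ℝ} (hδ : 0 < δ) (hδ1 : δ ≤ 7 / 25)
    {best : Fin (n + 1)} (hbest : ∀ i, i ≠ best → armMean ν i < armMean ν best) :
    1 - 3 * δ ^ 2 / (1 - δ ^ 2) - δ / (1 - δ) - 4 * δ ^ 2 ≤
      P.real {ω | StopsWithin δ (fun d => X d ω) best
        (97827200 * (Real.log (1 / δ) *
          (hardness ν best * Real.log (Real.log (1 / δ)) + logHardness ν best)))} := by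
  have hlam := six_fifths_le_log hδ hδ1
  have hδ1' : δ < 1 := by linarith
  have hlevel : ∀ i, ∃ L : ℕ, i ≠ best → 1 ≤ L ∧
      25 * Real.log (1 / δ) / (gap ν best i) ^ 2 < 2 ^ L ∧ (L * 2 ^ L : ℝ) ≤
      1900 * (Real.log (1 / δ) * (1 / gap ν best i ^ 2 * Real.log (Real.log (1 / δ)) +
        1 / gap ν best i ^ 2 * Real.logb 2 (1 / gap ν best i ^ 2))) := by
    intro i
    by_cases hi : i = best
    · exact ⟨0, fun hne => absurd hi hne⟩
    have := h.prob
    have hgap : 0 < gap ν best i := sub_pos.2 (hbest i hi)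
    have hgap1 : gap ν best i ≤ 1 := by
      have h1 := (armMean_mem_Icc (h.mem_Icc best)).2
      have h2 := (armMean_mem_Icc (h.mem_Icc i)).1
      unfold gap
      linarith
    obtain ⟨L, hL⟩ := exists_level hlam hgap hgap1
    exact ⟨L, fun _ => hL⟩
  choose L hL using hlevel
  set T := {ω | StopsWithin δ (fun d => X d ω) best
        (97827200 * (Real.log (1 / δ) *
          (hardness ν best * Real.log (Real.log (1 / δ)) + logHardness ν best)))} with hT
  set B₁ := {ω | ∃ ℓ, 1 ≤ ℓ ∧ ¬PhaseAccurate δ (armMean ν) best (fun d => X d ω) ℓ} with hB₁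
  set B₂ := {ω | ¬overestimation δ (armMean ν) best (fun d => X d ω) ≤ 3 * n} with hB₂
  have hP₁ : P.real B₁ ≤ 3 * δ ^ 2 / (1 - δ ^ 2) + δ / (1 - δ) := by
    have h1 : 0 < 1 - δ ^ 2 := by nlinarith
    have h2 : 0 < 1 - δ := by linarith
    exact ENNReal.toReal_le_of_le_ofReal (by positivity)
      (h.exists_phase_inaccurate_le hδ hδ1' best)
  have hP₂ : P.real B₂ ≤ 4 * δ ^ 2 := by
    refine ENNReal.toReal_le_of_le_ofReal (by positivity) ?_
    -- With a single arm the Markov threshold `3n` is zero and gives nothing, but the overestimation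
    -- is an empty sum.
    rcases eq_or_ne n 0 with rfl | hn
    · have : B₂ = ∅ := by
        refine Set.eq_empty_of_forall_notMem fun ω hω => hω ?_
        have he : Finset.univ.erase best = ∅ := Finset.card_eq_zero.1 (by
          rw [Finset.card_erase_of_mem (Finset.mem_univ _)]
          simp)
        rw [overestimation, he]
        simp
      simp [this]
    · exact (measure_mono fun ω hω => (not_le.1 hω).le).trans
        (h.overestimation_ge_le hδ hδ1 best hn)
  have hcover : Set.univ ⊆ T ∪ (B₁ ∪ B₂) := by
    intro ω _
    by_contra hcon
    simp only [Set.mem_union, not_or] at hcon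
    obtain ⟨h1, h2, h3⟩ := hcon
    simp only [hB₁, Set.mem_ofPred_eq, not_exists, not_and, not_not] at h2
    simp only [hB₂, Set.mem_ofPred_eq, not_not] at h3
    obtain ⟨K, hK, hset, hle⟩ := stopsWithin_of_accurate hδ (by linarith) hδ1' h2 hbest
      (fun i hi => (hL i hi).1) (fun i hi => (hL i hi).2.1) h3
    refine h1 ⟨K, hK, hset, hle.trans ?_⟩
    have h4 : ∑ i ∈ Finset.univ.erase best, (L i * 2 ^ L i : ℝ) ≤
        ∑ i ∈ Finset.univ.erase best, 1900 * (Real.log (1 / δ) *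
          (1 / gap ν best i ^ 2 * Real.log (Real.log (1 / δ)) +
          1 / gap ν best i ^ 2 * Real.logb 2 (1 / gap ν best i ^ 2))) :=
      Finset.sum_le_sum fun i hi => (hL i (Finset.ne_of_mem_erase hi)).2.2
    rw [← Finset.mul_sum, ← Finset.mul_sum, Finset.sum_add_distrib, ← Finset.sum_mul] at h4
    unfold hardness logHardness
    linarith
  have h1 : (1 : ℝ) ≤ P.real T + (P.real B₁ + P.real B₂) := by
    rw [← probReal_univ (μ := P)]
    exact (measureReal_mono hcover).trans ((measureReal_union_le _ _).trans
      (add_le_add le_rfl (measureReal_union_le _ _)))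
  linarith

end Main

end BestArm

theorem theorem1 :
    ∃ C : ℝ, 0 < C ∧
      ∀ (δ : ℝ), 0 < δ → δ < 1 →
      ∀ (n : ℕ) (ν : Fin (n + 1) → Measure ℝ),
        (∀ i, IsProbabilityMeasure (ν i)) →
        (∀ i, ∀ᵐ z ∂(ν i), z ∈ Set.Icc (0 : ℝ) 1) →
      ∀ (best : Fin (n + 1)), (∀ i, i ≠ best → BestArm.armMean ν i < BestArm.armMean ν best) →
      ∀ (Ω : Type*) [MeasurableSpace Ω] (P : Measure Ω) [IsProbabilityMeasure P]
        (X : BestArm.Draw n → Ω → ℝ),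
        (∀ d, Measurable (X d)) →
        (∀ d, P.map (X d) = ν d.arm) →
        iIndepFun X P →
        1 - 3 * δ ^ 2 / (1 - δ ^ 2) - δ / (1 - δ) - 4 * δ ^ 2 / (1 - δ ^ 2) ^ 2 ≤
          P.real {ω | BestArm.StopsWithin δ (fun d => X d ω) best
            (C * (Real.log (1 / δ) *
              (BestArm.hardness ν best * Real.log (Real.log (1 / δ)) +
                BestArm.logHardness ν best)))} := by
  -- `97827200 = 51488 · 1900`, from `stopsWithin_of_accurate` and `exists_level`.
  refine ⟨97827200, by norm_num, ?_⟩
  intro δ hδ hδ1 n ν hprob hIcc best hbest Ω _ P _ X hX hlaw hind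
  rcases le_or_gt δ (7 / 25) with h | h
  · have hs : BestArm.IsSampling ν X P := ⟨hprob, hIcc, hX, hlaw, hind⟩
    refine le_trans ?_ (hs.stopsWithin_ge hδ h hbest)
    have h1 : 0 < 1 - δ ^ 2 := by nlinarith
    have h2 : (1 - δ ^ 2) ^ 2 ≤ 1 := pow_le_one₀ h1.le (by nlinarith)
    -- Markov's inequality gave `4 δ²`, which is stronger than the error term claimed.
    have h3 : 4 * δ ^ 2 ≤ 4 * δ ^ 2 / (1 - δ ^ 2) ^ 2 :=
      le_div_self (by positivity) (by positivity) h2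
    linarith
  · exact (BestArm.confidence_nonpos h hδ1).trans measureReal_nonneg
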